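/- **Theorem 5.1 (Trotter–Kato product formula).** Let $(X,d)$ be a complete metric space of finite diameter and let $\lambda_1,\lambda_2\in\mathbb R$. Let $\varphi_1,\varphi_2:X\to(-\infty,\infty]$ be lower semi-continuous functions. Write $D(\psi):=\{\psi<\infty\}$ and $\varphi:=\varphi_1+\varphi_2$. Assume that for $i=1,2$ and every $Q\in\mathbb R$ the bounded subsets of $\{\varphi_i\le Q\}$ are relatively compact. A minimal geodesic is a curve $\gamma:[0,1]\to X$ with $d(\gamma(s),\gamma(t))=|s-t|\,d(\gamma(0),\gamma(1))$ for all $s,t$. A function $\psi:X\to(-\infty,\infty]$ is $\lambda$-convex along $\gamma$ (with endpoints in $D(\psi)$) if $\psi(\gamma(t))\le(1-t)\psi(\gamma(0))+t\psi(\gamma(1))-\frac\lambda2(1-t)t\,d^2(\gamma(0),\gamma(1))$ for all $t\in[0,1]$. Assume one of the following. * **Case I.** $X$ is a $\mathrm{CAT}(1)$-space, that is, any two points are joined by a minimal geodesic, and for all $x,y,z\in X$ with $d(x,y)+d(y,z)+d(z,x)<2\pi$ and every minimal geodesic $\gamma$ from $y$ to $z$ one has $d(x,\gamma(t))\le d_{\mathbb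 S^2}(\tilde x,\tilde\gamma(t))$ for all $t\in[0,1]$, where $\tilde x\tilde y\tilde z$ is a comparison triangle in the unit sphere $\mathbb S^2$ and $\tilde\gamma$ is the minimal geodesic from $\tilde y$ to $\tilde z$. Moreover, for $i=1,2$, $\varphi_i$ is $\lambda_i$-convex along some minimal geodesic between any two points of $D(\varphi_i)$. * **Case II.** There are a number $K\in\mathbb R$ and a family $\Gamma$ of minimal geodesics, joining any two points of $X$, such that: for every $x\in X$ the function $d^2(x,\cdot)$ is $K$-convex along every $\gamma\in\Gamma$; for all $\gamma,\eta\in\Gamma$ with $\gamma(0)=\eta(0)=x$, $\gamma(1)=y$, $\eta(1)=z$ the commutativity $$\lim_{s\downarrow0}\frac{d^2(\gamma(s),z)-d^2(x,z)}{s}=\lim_{t\downarrow0}\frac{d^2(\eta(t),y)-d^2(x,y)}{t}$$ holds; and, for $i=1,2$, $\varphi_i$ is $\lambda_i$-convex along every $\gamma\in\Gamma$ with endpoints in $D(\varphi_i)$. For $\psi:X\to(-\infty,\infty]$ and $\tau>0$ let $J^\psi_\tau(x)$ be the set of minimizers of $w\mapsto\psi(w)+\frac{d^2(x,w)}{2\tau}$.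 A partition is $\mathscr P_{\boldsymbol\tau}=\{0=t^0_{\boldsymbol\tau}<t^1_{\boldsymbol\tau}<\cdots\}$ with $t^k_{\boldsymbol\tau}\to\infty$; put $\tau_k:=t^k_{\boldsymbol\tau}-t^{k-1}_{\boldsymbol\tau}$ and $|\boldsymbol\tau|:=\sup_k\tau_k\in(0,\infty]$. To a sequence $(x^k)_{k\ge0}$ associate the interpolated curve $\bar x(0):=x^0$, $\bar x(t):=x^k$ for $t\in(t^{k-1}_{\boldsymbol\tau},t^k_{\boldsymbol\tau}]$. A discrete solution for $\psi$ from $x_0$ satisfies $x^0=x_0$ and $x^k\in J^\psi_{\tau_k}(x^{k-1})$ for $k\ge1$. A gradient curve of $\psi$ starting from $x_0\in D(\psi)$ is a curve $\xi:[0,\infty)\to X$ which is the pointwise limit of the interpolated curves of discrete solutions from $x_0$ along some sequence of partitions with $|\boldsymbol\tau_i|\to0$. Let $z_0\in D(\varphi)=D(\varphi_1)\cap D(\varphi_2)$ and consider the solutions of the alternating scheme $$z^0_{\boldsymbol\tau}=z_0,\qquad \hat z^k_{\boldsymbol\tau}\in J^{\varphi_1}_{\tau_k}(z^{k-1}_{\boldsymbol\tau}),\qquad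 z^k_{\boldsymbol\tau}\in J^{\varphi_2}_{\tau_k}(\hat z^k_{\boldsymbol\tau})\qquad(k\ge1).$$ Put $\delta^k_{\boldsymbol\tau}:=\max\{0,\ \varphi_2(\hat z^k_{\boldsymbol\tau})-\varphi_2(z^{k-1}_{\boldsymbol\tau}),\ \varphi_1(z^k_{\boldsymbol\tau})-\varphi_1(\hat z^k_{\boldsymbol\tau})\}$ and assume that for all $\varepsilon,T>0$ there is $\Delta^T_\varepsilon<\infty$ with $\sum_{k=1}^N\delta^k_{\boldsymbol\tau}\le\Delta^T_\varepsilon$ for all partitions with $|\boldsymbol\tau|<\varepsilon$, all $N$ with $t^N_{\boldsymbol\tau}\le T$ and all solutions of the alternating scheme. Then the alternating scheme is solvable for every partition, there is exactly one gradient curve $\xi$ of $\varphi$ starting from $z_0$, and the interpolated curves $\bar z_{\boldsymbol\tau}$ converge to $\xi$ as $|\boldsymbol\tau|\to0$, uniformly on bounded intervals: for all $T,\rho>0$ there is $\eta>0$ such that $d(\bar z_{\boldsymbol\tau}(t),\xi(t))<\rho$ for all $t\in[0,T]$, for every partition with $|\boldsymbol\tau|<\eta$ and every solution of the alternating scheme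 from $z_0$. -/

import Mathlib

open Set Filter Topology

noncomputable section

namespace TrotterKato

/-! ### Geodesics and CAT(1)-spaces -/

/-- `γ`, restricted to `[0,1]`, is a minimal geodesic. Values outside `[0,1]` are irrelevant. -/
def IsMinGeodesic {X : Type*} [MetricSpace X] (γ : ℝ → X) : Prop :=
  ∀ s ∈ Icc (0 : ℝ) 1, ∀ t ∈ Icc (0 : ℝ) 1, dist (γ s) (γ t) = |s - t| * dist (γ 0) (γ 1)

/-- Any two points are joined by a minimal geodesic. -/
def IsGeodesicSpace (X : Type*) [MetricSpace X] : Prop :=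
  ∀ x y : X, ∃ γ : ℝ → X, IsMinGeodesic γ ∧ γ 0 = x ∧ γ 1 = y

/-- The unit sphere `𝕊²` in Euclidean `ℝ³`. -/
abbrev S2 : Type := Metric.sphere (0 : EuclideanSpace ℝ (Fin 3)) 1

/-- The intrinsic (angular) distance of `𝕊²`. -/
def sphDist (p q : S2) : ℝ :=
  InnerProductGeometry.angle (p : EuclideanSpace ℝ (Fin 3)) (q : EuclideanSpace ℝ (Fin 3))

/-- Minimal geodesics of `𝕊²` for the angular distance. -/
def IsSphMinGeodesic (c : ℝ → S2) : Prop :=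
  ∀ s ∈ Icc (0 : ℝ) 1, ∀ t ∈ Icc (0 : ℝ) 1, sphDist (c s) (c t) = |s - t| * sphDist (c 0) (c 1)

/-- `CAT(1)`-spaces: a geodesic space in which, for every triple of points of perimeter `< 2π` and
every minimal geodesic `γ` between the last two of them, distances from the first point to `γ` are
at most those in the comparison triangle in `𝕊²`. The comparison triangle, which always exists and
is unique up to isometries of `𝕊²`, has the vertices `x'`, `c 0`, `c 1`. -/
def IsCAT1 (X : Type*) [MetricSpace X] : Prop :=
  IsGeodesicSpace X ∧
    ∀ (x y z : X), dist x y + dist y z + dist z x < 2 * Real.pi →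
      ∀ γ : ℝ → X, IsMinGeodesic γ → γ 0 = y → γ 1 = z →
        ∃ (x' : S2) (c : ℝ → S2), IsSphMinGeodesic c ∧
          sphDist x' (c 0) = dist x y ∧ sphDist (c 0) (c 1) = dist y z ∧
          sphDist (c 1) x' = dist z x ∧
          ∀ t ∈ Icc (0 : ℝ) 1, dist x (γ t) ≤ sphDist x' (c t)

/-! ### Extended-valued functions and semi-convexity -/

/-- The effective domain `D(φ) = {φ < ∞}` (for functions `φ` with values in `(-∞, ∞]`). -/
def effDomain {X : Type*} (φ : X → EReal) : Set X := {x | φ x ≠ ⊤}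

/-- The `l`-convexity inequality of `φ` along the curve `γ` on `[0,1]`; it is only used when `φ` is
finite at the end points. -/
def ConvexAlong {X : Type*} [MetricSpace X] (l : ℝ) (φ : X → EReal) (γ : ℝ → X) : Prop :=
  ∀ t ∈ Icc (0 : ℝ) 1,
    φ (γ t) ≤ (((1 - t) * (φ (γ 0)).toReal + t * (φ (γ 1)).toReal
      - l / 2 * ((1 - t) * t) * dist (γ 0) (γ 1) ^ 2 : ℝ) : EReal)

/-- `φ` is `l`-convex: the inequality holds along some minimal geodesic between any two points of
the effective domain. -/
def IsLConvex {X : Type*} [MetricSpace X] (l : ℝ) (φ : X → EReal) : Prop :=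
  ∀ x ∈ effDomain φ, ∀ y ∈ effDomain φ,
    ∃ γ : ℝ → X, IsMinGeodesic γ ∧ γ 0 = x ∧ γ 1 = y ∧ ConvexAlong l φ γ

/-- `Γ` is a family of minimal geodesics which joins any two points. -/
def IsGeodesicFamily {X : Type*} [MetricSpace X] (Γ : Set (ℝ → X)) : Prop :=
  (∀ γ ∈ Γ, IsMinGeodesic γ) ∧ ∀ x y : X, ∃ γ ∈ Γ, γ 0 = x ∧ γ 1 = y

/-- `φ` is `l`-convex along the geodesics of the family `Γ` with end points in `D(φ)`. -/
def IsLConvexAlong {X : Type*} [MetricSpace X] (Γ : Set (ℝ → X)) (l : ℝ) (φ : X → EReal) : Prop :=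
  ∀ γ ∈ Γ, γ 0 ∈ effDomain φ → γ 1 ∈ effDomain φ → ConvexAlong l φ γ

/-- `K`-convexity of all functions `d²(x, ·)` along the family `Γ`. -/
def SqDistConvexAlong {X : Type*} [MetricSpace X] (Γ : Set (ℝ → X)) (K : ℝ) : Prop :=
  ∀ x : X, IsLConvexAlong Γ K (fun z => ((dist x z ^ 2 : ℝ) : EReal))

/-- Commutativity of the family `Γ`: for two geodesics `γ`, `η` of `Γ` issuing from the same point,
the one-sided derivative at `0` of `d²(γ(s), η(1))` equals that of `d²(η(t), γ(1))`. -/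
def IsCommutative {X : Type*} [MetricSpace X] (Γ : Set (ℝ → X)) : Prop :=
  ∀ γ ∈ Γ, ∀ η ∈ Γ, γ 0 = η 0 →
    ∃ L : ℝ,
      Tendsto (fun s : ℝ => (dist (γ s) (η 1) ^ 2 - dist (γ 0) (η 1) ^ 2) / s) (𝓝[>] 0) (𝓝 L) ∧
      Tendsto (fun t : ℝ => (dist (η t) (γ 1) ^ 2 - dist (η 0) (γ 1) ^ 2) / t) (𝓝[>] 0) (𝓝 L)

/-- Bounded subsets of sub-level sets of `φ` are relatively compact. -/
def SublevelsCompact {X : Type*} [MetricSpace X] (φ : X → EReal) : Prop :=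
  ∀ (Q : ℝ) (S : Set X), S ⊆ {x | φ x ≤ (Q : EReal)} → Bornology.IsBounded S →
    IsCompact (closure S)

/-! ### Variational schemes -/

/-- The Moreau-Yosida approximation `φ_τ`. -/
def moreauYosida {X : Type*} [MetricSpace X] (φ : X → EReal) (τ : ℝ) (x : X) : EReal :=
  ⨅ z : X, φ z + ((dist x z ^ 2 / (2 * τ) : ℝ) : EReal)

/-- The set `J_τ^φ(x)` of points attaining the infimum `φ_τ(x)`. -/
def proxSet {X : Type*} [MetricSpace X] (φ : X → EReal) (τ : ℝ) (x : X) : Set X :=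
  {z | φ z + ((dist x z ^ 2 / (2 * τ) : ℝ) : EReal) = moreauYosida φ τ x}

/-- Partitions `0 = t⁰ < t¹ < ⋯ → ∞` of `[0, ∞)`. -/
structure TimePartition where
  t : ℕ → ℝ
  t_zero : t 0 = 0
  strictMono : StrictMono t
  tendsto : Tendsto t atTop atTop

/-- The length of the step that follows `tᵏ`, that is `τ_{k+1} = tᵏ⁺¹ - tᵏ`. -/
def TimePartition.step (P : TimePartition) (k : ℕ) : ℝ := P.t (k + 1) - P.t k

/-- The mesh `|τ|`, the supremum of the step lengths; it may be infinite. -/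
def TimePartition.mesh (P : TimePartition) : EReal := ⨆ k : ℕ, ((P.step k : ℝ) : EReal)

/-- The piecewise constant interpolation of `(x k)`: the value at `t` is `x k` for the least `k`
with `t ≤ tᵏ`. -/
def interp {X : Type*} (P : TimePartition) (x : ℕ → X) (t : ℝ) : X :=
  x (sInf {k : ℕ | t ≤ P.t k})

theorem interp_zero {X : Type*} (P : TimePartition) (x : ℕ → X) : interp P x 0 = x 0 := by
  have h : sInf {k : ℕ | (0 : ℝ) ≤ P.t k} = 0 :=
    Nat.sInf_eq_zero.2 (Or.inl (by simp [P.t_zero]))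
  simp [interp, h]

theorem interp_of_mem {X : Type*} (P : TimePartition) (x : ℕ → X) (k : ℕ) (t : ℝ)
    (ht : t ∈ Ioc (P.t k) (P.t (k + 1))) : interp P x t = x (k + 1) := by
  have h : sInf {j : ℕ | t ≤ P.t j} = k + 1 := by
    apply le_antisymm
    · exact Nat.sInf_le ht.2
    · refine le_csInf ⟨k + 1, ht.2⟩ fun j hj => ?_
      have h1 : P.t k < P.t j := lt_of_lt_of_le ht.1 hj
      exact P.strictMono.lt_iff_lt.1 h1
  simp [interp, h]

/-- Discrete solutions of the variational scheme for `φ` starting from `x₀`. -/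
def IsDiscreteSolution {X : Type*} [MetricSpace X] (φ : X → EReal) (P : TimePartition) (x₀ : X)
    (x : ℕ → X) : Prop :=
  x 0 = x₀ ∧ ∀ k : ℕ, x (k + 1) ∈ proxSet φ (P.step k) (x k)

/-- `ξ` (on `[0, ∞)`) is a gradient curve of `φ` starting from `x₀`: it is the pointwise limit of
the interpolations of discrete solutions starting from `x₀`, along some sequence of partitions
whose meshes tend to `0`. -/
def IsGradientCurve {X : Type*} [MetricSpace X] (φ : X → EReal) (x₀ : X) (ξ : ℝ → X) : Prop :=
  ∃ (P : ℕ → TimePartition) (x : ℕ → ℕ → X),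
    (∀ i, IsDiscreteSolution φ (P i) x₀ (x i)) ∧
    Tendsto (fun i => (P i).mesh) atTop (𝓝 0) ∧
    ∀ t : ℝ, 0 ≤ t → Tendsto (fun i => interp (P i) (x i) t) atTop (𝓝 (ξ t))

/-- Solutions of the alternating scheme: a `φ₁`-step from `z k` to `zh (k+1)` followed by a
`φ₂`-step from `zh (k+1)` to `z (k+1)`. The value `zh 0` is not used. -/
def IsSplitSolution {X : Type*} [MetricSpace X] (φ₁ φ₂ : X → EReal) (P : TimePartition) (z₀ : X)
    (zh z : ℕ → X) : Prop :=
  z 0 = z₀ ∧ ∀ k : ℕ, zh (k + 1) ∈ proxSet φ₁ (P.step k) (z k) ∧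
    z (k + 1) ∈ proxSet φ₂ (P.step k) (zh (k + 1))

/-- The increment `δ^{k+1}`, with values in `[0, ∞]`. -/
def increment {X : Type*} (φ₁ φ₂ : X → EReal) (zh z : ℕ → X) (k : ℕ) : EReal :=
  max 0 (max (φ₂ (zh (k + 1)) - φ₂ (z k)) (φ₁ (z (k + 1)) - φ₁ (zh (k + 1))))

/-- For all `ε, T > 0` the sums `δ¹ + ⋯ + δᴺ` with `tᴺ ≤ T` are bounded, uniformly over all
partitions of mesh `< ε` and all solutions of the alternating scheme starting from `z₀`. -/
def IncrementsSummable {X : Type*} [MetricSpace X] (φ₁ φ₂ : X → EReal) (z₀ : X) : Prop :=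
  ∀ ε : ℝ, 0 < ε → ∀ T : ℝ, 0 < T → ∃ Δ : ℝ,
    ∀ P : TimePartition, P.mesh < (ε : EReal) → ∀ N : ℕ, P.t N ≤ T →
      ∀ zh z : ℕ → X, IsSplitSolution φ₁ φ₂ P z₀ zh z →
        ∑ k ∈ Finset.range N, increment φ₁ φ₂ zh z k ≤ (Δ : EReal)

end TrotterKato

end

namespace TrotterKato

/-! ### Spherical comparison -/

/-! Both time-discrete schemes, the implicit steps for the sum and the alternating steps, satisfy
the same approximate evolution variational inequality (EVI), and any two sequences satisfying it
from the same starting point stay close when the meshes are small.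

The geometry enters only through a first variation bound (`HasVariationBound`): at the start of a
geodesic from `z` to `y`, the slope of `d²(x, ·)` is at most `d²(x,y) - d²(z,y) + C d²(x,z)`. In a
CAT(1)-space this is the spherical law of cosines for small triangles; in the commutative case the
slope is exchanged for one along a geodesic from `z` to `x`, where semi-convexity bounds it. Testing
the minimality of a proximal point against points of such a geodesic gives a discrete EVI, valid for
nearby points (`IsLocallyConvex.hasLocalEVI`). For the alternating scheme the EVIs of the two half
steps are added; the energies evaluated at the wrong point cost the increments `δ`, whose sums are
bounded (`split_step`).

Two EVI sequences `z`, `w` are compared by doubling the time variable: testing each EVI at the other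
sequence and weighting by the opposite step eliminates the energy. This leaves a recursion for `d²(z
j, w k)`, which is dominated by an explicit majorant (`IsEVISeq.dist_sq_le_majorant`). Since the EVI
is local, the induction must also show that the points are near each other: far from the diagonal of
the time plane the majorant exceeds the squared diameter, and near it the points are close by
induction and Hölder continuity. Hence interpolations of either scheme are uniformly Cauchy as the
mesh tends to zero, and completeness gives one common limit. -/

theorem cos_sphDist (p q : S2) :
    Real.cos (sphDist p q) =
      inner ℝ (p : EuclideanSpace ℝ (Fin 3)) (q : EuclideanSpace ℝ (Fin 3)) := by
  have hp : ‖(p : EuclideanSpace ℝ (Fin 3))‖ = 1 := by simp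
  have hq : ‖(q : EuclideanSpace ℝ (Fin 3))‖ = 1 := by simp
  rw [sphDist, InnerProductGeometry.cos_angle, hp, hq]
  simp

/-- Spherical interpolation: `sin b • c t = sin ((1-t)b) • c 0 + sin (tb) • c 1` in the ambient
space, because the difference has norm zero by the prescribed angles. Pairing with `x` gives the
formula. -/
theorem cos_sphDist_geodesic {c : ℝ → S2} (hc : IsSphMinGeodesic c) (x : S2)
    {t : ℝ} (ht : t ∈ Icc (0 : ℝ) 1) :
    Real.cos (sphDist x (c t)) * Real.sin (sphDist (c 0) (c 1)) =
      Real.sin ((1 - t) * sphDist (c 0) (c 1)) * Real.cos (sphDist x (c 0)) +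
        Real.sin (t * sphDist (c 0) (c 1)) * Real.cos (sphDist x (c 1)) := by
  have h0 := hc t ht 0 (by simp)
  have h1 := hc t ht 1 (by simp)
  rw [sub_zero, abs_of_nonneg ht.1] at h0
  rw [abs_sub_comm, abs_of_nonneg (sub_nonneg.2 ht.2)] at h1
  set b := sphDist (c 0) (c 1) with hbdef
  have e0 := cos_sphDist (c t) (c 0)
  have e1 := cos_sphDist (c t) (c 1)
  have e01 := cos_sphDist (c 0) (c 1)
  rw [h0] at e0
  rw [h1] at e1
  rw [← hbdef] at e01
  rw [cos_sphDist, cos_sphDist, cos_sphDist]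
  have hn : ∀ p : S2, inner ℝ (p : EuclideanSpace ℝ (Fin 3)) (p : EuclideanSpace ℝ (Fin 3))
      = 1 := fun p => by simp
  have hsb : Real.sin b = Real.sin ((1 - t) * b) * Real.cos (t * b) +
      Real.cos ((1 - t) * b) * Real.sin (t * b) := by
    rw [← Real.sin_add]; ring_nf
  have hcb : Real.cos b = Real.cos ((1 - t) * b) * Real.cos (t * b) -
      Real.sin ((1 - t) * b) * Real.sin (t * b) := by
    rw [← Real.cos_add]; ring_nf
  have hv : Real.sin b • (c t : EuclideanSpace ℝ (Fin 3)) -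
      (Real.sin ((1 - t) * b) • (c 0 : EuclideanSpace ℝ (Fin 3)) +
        Real.sin (t * b) • (c 1 : EuclideanSpace ℝ (Fin 3))) = 0 := by
    rw [← inner_self_eq_zero (𝕜 := ℝ)]
    simp only [inner_sub_left, inner_sub_right, inner_add_left, inner_add_right,
      real_inner_smul_left, real_inner_smul_right, hn]
    rw [real_inner_comm (c t : EuclideanSpace ℝ (Fin 3)) (c 0 : EuclideanSpace ℝ (Fin 3)),
      real_inner_comm (c t : EuclideanSpace ℝ (Fin 3)) (c 1 : EuclideanSpace ℝ (Fin 3)),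
      real_inner_comm (c 0 : EuclideanSpace ℝ (Fin 3)) (c 1 : EuclideanSpace ℝ (Fin 3)),
      ← e0, ← e1, ← e01, hcb, hsb]
    have q0 := Real.sin_sq_add_cos_sq ((1 - t) * b)
    have q1 := Real.sin_sq_add_cos_sq (t * b)
    have q0' : Real.cos ((1 - t) * b) ^ 2 = 1 - Real.sin ((1 - t) * b) ^ 2 := by linarith
    have q1' : Real.cos (t * b) ^ 2 = 1 - Real.sin (t * b) ^ 2 := by linarith
    ring_nf
    ring_nf at q0' q1'
    simp only [q0', q1']
    ring
  have := congrArg (fun v => inner ℝ (x : EuclideanSpace ℝ (Fin 3)) v) (sub_eq_zero.1 hv)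
  simp only [inner_add_right, real_inner_smul_right] at this
  linarith


/-- The cosine form of the `CAT(1)` inequality. -/
theorem IsCAT1.cos_ineq {X : Type*} [MetricSpace X] (hX : IsCAT1 X) {x : X} {γ : ℝ → X}
    (hγ : IsMinGeodesic γ) (hp : dist x (γ 0) + dist (γ 0) (γ 1) + dist (γ 1) x < 2 * Real.pi)
    (hb : 0 < dist (γ 0) (γ 1)) (hb' : dist (γ 0) (γ 1) < Real.pi) {t : ℝ}
    (ht : t ∈ Icc (0 : ℝ) 1) :
    Real.sin ((1 - t) * dist (γ 0) (γ 1)) * Real.cos (dist x (γ 0)) +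
        Real.sin (t * dist (γ 0) (γ 1)) * Real.cos (dist x (γ 1)) ≤
      Real.cos (dist x (γ t)) * Real.sin (dist (γ 0) (γ 1)) := by
  obtain ⟨x', c, hc, h0, h01, h1, hle⟩ := hX.2 x _ _ hp γ hγ rfl rfl
  have hs : 0 < Real.sin (dist (γ 0) (γ 1)) := Real.sin_pos_of_pos_of_lt_pi hb hb'
  have h1' : sphDist x' (c 1) = dist x (γ 1) := by
    rw [dist_comm x, ← h1]; exact InnerProductGeometry.angle_comm _ _
  have key := cos_sphDist_geodesic hc x' ht
  rw [h01, h0, h1'] at key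
  rw [← key]
  exact mul_le_mul_of_nonneg_right (Real.cos_le_cos_of_nonneg_of_le_pi dist_nonneg
    (InnerProductGeometry.angle_le_pi _ _) (hle t ht)) hs.le

/-- Short minimal geodesics of `CAT(1)`-spaces are determined by their end points. -/
theorem IsCAT1.geodesic_unique {X : Type*} [MetricSpace X] (hX : IsCAT1 X) {γ η : ℝ → X}
    (hγ : IsMinGeodesic γ) (hη : IsMinGeodesic η) (h0 : η 0 = γ 0) (h1 : η 1 = γ 1)
    (hb : dist (γ 0) (γ 1) < Real.pi / 2) {t : ℝ} (ht : t ∈ Icc (0 : ℝ) 1) : η t = γ t := by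
  have hpi := Real.pi_pos
  have e0 : dist (η t) (γ 0) = t * dist (γ 0) (γ 1) := by
    have := hη t ht 0 (by simp)
    rwa [sub_zero, abs_of_nonneg ht.1, h0, h1] at this
  have e1 : dist (η t) (γ 1) = (1 - t) * dist (γ 0) (γ 1) := by
    have := hη t ht 1 (by simp)
    rwa [abs_sub_comm, abs_of_nonneg (sub_nonneg.2 ht.2), h0, h1] at this
  have g0 : dist (γ t) (γ 0) = t * dist (γ 0) (γ 1) := by
    have := hγ t ht 0 (by simp)
    rwa [sub_zero, abs_of_nonneg ht.1] at this
  rcases (dist_nonneg (x := γ 0) (y := γ 1)).eq_or_lt with hz | hz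
  · rw [← hz, mul_zero, dist_eq_zero] at e0 g0
    rw [e0, g0]
  -- The comparison triangle with apex `η t` is degenerate, so the left side is `sin b` and the
  -- inequality forces `cos (dist (η t) (γ t)) = 1`.
  have key := hX.cos_ineq (x := η t) hγ (by rw [dist_comm (γ 1), e0, e1]; nlinarith [ht.1]) hz
    (by linarith) ht
  have hs : 0 < Real.sin (dist (γ 0) (γ 1)) :=
    Real.sin_pos_of_pos_of_lt_pi hz (by linarith)
  have hsum : Real.sin ((1 - t) * dist (γ 0) (γ 1)) * Real.cos (t * dist (γ 0) (γ 1)) +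
      Real.sin (t * dist (γ 0) (γ 1)) * Real.cos ((1 - t) * dist (γ 0) (γ 1)) =
      Real.sin (dist (γ 0) (γ 1)) := by
    rw [mul_comm (Real.sin (t * _)), ← Real.sin_add]; ring_nf
  rw [e0, e1, hsum] at key
  have hcos : Real.cos (dist (η t) (γ t)) = 1 :=
    le_antisymm (Real.cos_le_one _) (by nlinarith)
  have hd : dist (η t) (γ t) ≤ 2 * (t * dist (γ 0) (γ 1)) := by
    have := dist_triangle_right (η t) (γ t) (γ 0)
    linarith
  have hlt : dist (η t) (γ t) < 2 * Real.pi := by nlinarith [ht.2, hz]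
  have := (Real.cos_eq_one_iff_of_lt_of_lt (by linarith [dist_nonneg (x := η t) (y := γ t)])
    hlt).1 hcos
  exact dist_eq_zero.1 this

/-! ### Quantitative trigonometry of small spherical triangles -/

theorem abs_cos_sub_cos_add_le {p q : ℝ} (hpq : |q - p| ≤ 1) :
    |Real.cos q - Real.cos p + Real.sin p * (q - p)| ≤ 2 / 3 * (q - p) ^ 2 := by
  have e : Real.cos q = Real.cos p * Real.cos (q - p) - Real.sin p * Real.sin (q - p) := by
    rw [← Real.cos_add]; ring_nf
  have e' : Real.cos q - Real.cos p + Real.sin p * (q - p) =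
      Real.cos p * (Real.cos (q - p) - 1) + Real.sin p * (q - p - Real.sin (q - p)) := by
    rw [e]; ring
  have h1 : |Real.cos (q - p) - 1| ≤ (q - p) ^ 2 / 2 := by
    rw [abs_le]
    constructor <;> nlinarith [Real.one_sub_sq_div_two_le_cos (x := q - p),
      Real.cos_le_one (q - p)]
  have h2 : |q - p - Real.sin (q - p)| ≤ (q - p) ^ 2 / 6 := by
    refine (Real.abs_sub_sin_le _).trans ?_
    rw [← sq_abs (q - p)]
    nlinarith [sq_nonneg |q - p|]
  rw [e']
  refine (abs_add_le _ _).trans ?_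
  rw [abs_mul, abs_mul]
  nlinarith [mul_le_mul (Real.abs_cos_le_one p) h1 (abs_nonneg _) zero_le_one,
    mul_le_mul (Real.abs_sin_le_one p) h2 (abs_nonneg _) zero_le_one]

/-- The factor `p / sin p` converts spherical quantities into Euclidean ones; the bound `1 + p ^ 2`
keeps the conversion error quadratic. -/
theorem exists_mul_sin_eq {p : ℝ} (hp : 0 < p) (hp1 : p ≤ 1) :
    ∃ A, A * Real.sin p = p ∧ 1 ≤ A ∧ A ≤ 4 / 3 ∧ A ≤ 1 + p ^ 2 := by
  have hs : 0 < Real.sin p := Real.sin_pos_of_pos_of_lt_pi hp (by linarith [Real.pi_gt_three])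
  have h3 := Real.sin_gt_sub_cube hp
  have hlt := Real.sin_lt hp
  refine ⟨p / Real.sin p, by field_simp, (one_le_div hs).2 hlt.le, ?_, ?_⟩
  · rw [div_le_iff₀ hs]; nlinarith [sq_nonneg p]
  · rw [div_le_iff₀ hs];
    nlinarith [mul_lt_mul_of_pos_left h3 (by positivity : 0 < 1 + p ^ 2), pow_pos hp 3,
      mul_le_mul_of_nonneg_left (pow_le_one₀ hp.le hp1 : p ^ 2 ≤ 1) (pow_pos hp 3).le]

/-- Expanding the sines to first order in `t` and dividing by `sin b` leaves the slope `B (cos c -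
cos a cos b)`; all remainders fit into `t ^ 2`. Here `a`, `b`, `c` are the sides of the triangle and
`u` is the distance from the apex to the point at time `t`. -/
theorem cos_sub_cos_ge_of_cos_ineq {a b c u t B : ℝ} (ha : 0 < a) (ha1 : a ≤ 1) (hb : 0 < b)
    (hb1 : b ≤ 1) (ht : 0 < t) (ht1 : t ≤ 1) (hB : B * Real.sin b = b) (hB2 : B ≤ 4 / 3)
    (h : Real.sin ((1 - t) * b) * Real.cos a + Real.sin (t * b) * Real.cos c ≤
      Real.cos u * Real.sin b) :
    t * B * (Real.cos c - Real.cos a * Real.cos b) - t ^ 2 ≤ Real.cos u - Real.cos a := by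
  have hsb : 0 < Real.sin b := Real.sin_pos_of_pos_of_lt_pi hb (by linarith [Real.pi_gt_three])
  have hcb : 0 ≤ Real.cos b := Real.cos_nonneg_of_mem_Icc
    ⟨by linarith [Real.pi_gt_three], by linarith [Real.pi_gt_three]⟩
  have hca := Real.cos_le_one a
  have htb : 0 < t * b := mul_pos ht hb
  have htb1 : t * b ≤ t := by nlinarith
  have hca0 : 0 ≤ Real.cos a := Real.cos_nonneg_of_mem_Icc
    ⟨by linarith [Real.pi_gt_three], by linarith [Real.pi_gt_three]⟩
  have e : Real.sin ((1 - t) * b) =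
      Real.sin b * Real.cos (t * b) - Real.cos b * Real.sin (t * b) := by
    rw [← Real.sin_sub]; ring_nf
  have k1 : -(t ^ 2 / 2) ≤ Real.cos (t * b) - 1 := by
    have : (t * b) ^ 2 ≤ t ^ 2 := pow_le_pow_left₀ htb.le htb1 2
    linarith [Real.one_sub_sq_div_two_le_cos (x := t * b)]
  have k2 : -(t ^ 2 / 2) ≤ (Real.cos (t * b) - 1) * Real.cos a := by
    nlinarith [Real.cos_le_one (t * b), mul_nonneg (sub_nonneg.2 (Real.cos_le_one (t * b)))
      (sub_nonneg.2 hca)]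
  set Q := Real.cos c - Real.cos a * Real.cos b with hQ
  have hQ2 : |Q| ≤ 2 := by
    rw [hQ, abs_le]
    constructor <;> nlinarith [Real.cos_le_one c, Real.neg_one_le_cos c, Real.cos_le_one b]
  have hs3 : |Real.sin (t * b) - t * b| ≤ t ^ 2 * b / 6 := by
    rw [abs_sub_comm]
    refine (Real.abs_sub_sin_le _).trans ?_
    rw [abs_of_pos htb]
    have : t * b ^ 2 ≤ 1 := by nlinarith [pow_le_one₀ hb.le hb1 (n := 2), sq_nonneg b]
    nlinarith [mul_le_mul_of_nonneg_left this (by positivity : 0 ≤ t ^ 2 * b)]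
  have hsQ : -(t ^ 2 * b / 3) ≤ (Real.sin (t * b) - t * b) * Q := by
    have : |(Real.sin (t * b) - t * b) * Q| ≤ t ^ 2 * b / 6 * 2 := by
      rw [abs_mul]
      exact mul_le_mul hs3 hQ2 (abs_nonneg _) (by positivity)
    linarith [(abs_le.1 this).1]
  have hbs : b ≤ 4 / 3 * Real.sin b := by nlinarith
  have hfin : (t * B * Q - t ^ 2) * Real.sin b ≤ (Real.cos u - Real.cos a) * Real.sin b := by
    rw [e] at h
    have i1 : t * B * Q * Real.sin b = t * b * Q := by linear_combination t * Q * hB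
    have i2 := mul_le_mul_of_nonneg_right k2 hsb.le
    have i3 : t ^ 2 * b ≤ t ^ 2 * (4 / 3 * Real.sin b) :=
      mul_le_mul_of_nonneg_left hbs (sq_nonneg t)
    have i4 : 0 ≤ t ^ 2 * Real.sin b := by positivity
    have i5 : Real.sin (t * b) * Q = Real.sin (t * b) * Real.cos c -
      Real.sin (t * b) * (Real.cos a * Real.cos b) := by rw [hQ]; ring
    linarith
  exact le_of_mul_le_mul_right hfin hsb

/-- On the sphere `cos c - cos a cos b` is `sin a sin b` times the cosine of the angle between the
sides `a` and `b`, so this is the Euclidean law of cosines with an error. The error is quadratic in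
`a` alone because `|c - b| ≤ a`. -/
theorem spherical_law_estimate {a b c A B : ℝ} (ha1 : a ≤ 1) (hb : 0 < b) (hb1 : b ≤ 1)
    (hc : |c - b| ≤ a) (hA1 : 1 ≤ A) (hA3 : A ≤ 1 + a ^ 2) (hB : B * Real.sin b = b) (hB1 : 1 ≤ B)
    (hB2 : B ≤ 4 / 3) :
    -(2 * A * B) * (Real.cos c - Real.cos a * Real.cos b) ≤ c ^ 2 - b ^ 2 + 10 * a ^ 2 := by
  have hcb : 0 ≤ Real.cos b := Real.cos_nonneg_of_mem_Icc
    ⟨by linarith [Real.pi_gt_three], by linarith [Real.pi_gt_three]⟩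
  have hca := Real.cos_le_one a
  have t1 := (abs_le.1 (abs_cos_sub_cos_add_le (p := b) (q := c) (hc.trans ha1))).1
  have t2 : (c - b) ^ 2 ≤ a ^ 2 := sq_le_sq' (abs_le.1 hc).1 (abs_le.1 hc).2
  have f1 : -(a ^ 2) ≤ c ^ 2 - b ^ 2 + 2 * B * (Real.cos c - Real.cos b) := by
    have g1 := mul_le_mul_of_nonneg_left t1 (by linarith : 0 ≤ 2 * B)
    have g2 := mul_le_mul_of_nonneg_right hB2 (sq_nonneg (c - b))
    have g3 : 2 * B * (Real.sin b * (c - b)) = 2 * b * (c - b) := by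
      linear_combination 2 * (c - b) * hB
    linarith
  have f2 : 0 ≤ A * B * Real.cos b * (1 - Real.cos a) :=
    mul_nonneg (mul_nonneg (mul_nonneg (by linarith) (by linarith)) hcb) (by linarith)
  have f3 : -(4 * a ^ 2) ≤ B * ((A - 1) * (Real.cos c - Real.cos b)) := by
    have g1 : -2 ≤ Real.cos c - Real.cos b := by
      linarith [Real.neg_one_le_cos c, Real.cos_le_one b]
    have g2 : -(2 * a ^ 2) ≤ (A - 1) * (Real.cos c - Real.cos b) := by
      linarith [mul_le_mul_of_nonneg_left g1 (by linarith : 0 ≤ A - 1)]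
    linarith [mul_le_mul_of_nonneg_left g2 (by linarith : 0 ≤ B),
      mul_le_mul_of_nonneg_right hB2 (sq_nonneg a), sq_nonneg a]
  linarith [sq_nonneg a]

/-- The spherical estimate behind the first variation inequality. -/
theorem sq_sub_sq_le_of_cos_ineq {a b c u t : ℝ} (ha : 0 < a) (ha1 : a ≤ 1) (hb : 0 < b)
    (hb1 : b ≤ 1) (hc : |c - b| ≤ a) (hu : |u - a| ≤ t * b) (ht : 0 < t) (ht1 : t ≤ 1)
    (h : Real.sin ((1 - t) * b) * Real.cos a + Real.sin (t * b) * Real.cos c ≤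
      Real.cos u * Real.sin b) :
    u ^ 2 - a ^ 2 ≤ t * (c ^ 2 - b ^ 2 + 10 * a ^ 2) + 20 * t ^ 2 := by
  obtain ⟨A, hA, hA1, hA2, hA3⟩ := exists_mul_sin_eq ha ha1
  obtain ⟨B, hB, hB1, hB2, -⟩ := exists_mul_sin_eq hb hb1
  have step1 := cos_sub_cos_ge_of_cos_ineq ha ha1 hb hb1 ht ht1 hB hB2 h
  have step2 : u ^ 2 - a ^ 2 ≤
      -(2 * A) * (Real.cos u - Real.cos a) + (1 + 4 / 3 * A) * (u - a) ^ 2 := by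
    have := (abs_le.1 (abs_cos_sub_cos_add_le (p := a) (q := u) (hu.trans (by nlinarith)))).2
    nlinarith [mul_le_mul_of_nonneg_left this (by linarith : 0 ≤ A)]
  have step3 := spherical_law_estimate ha1 hb hb1 hc hA1 hA3 hB hB1 hB2
  have hsq : (u - a) ^ 2 ≤ t ^ 2 := by
    have : (u - a) ^ 2 ≤ (t * b) ^ 2 := sq_le_sq' (abs_le.1 hu).1 (abs_le.1 hu).2
    exact this.trans (pow_le_pow_left₀ (by positivity) (by nlinarith) 2)
  linarith [mul_le_mul_of_nonneg_left step1 (by linarith : 0 ≤ 2 * A),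
    mul_le_mul_of_nonneg_left step3 ht.le,
    mul_le_mul_of_nonneg_left hsq (by linarith : 0 ≤ 1 + 4 / 3 * A), sq_nonneg t,
    mul_le_mul_of_nonneg_right hA2 (sq_nonneg t)]

/-! ### First variation bounds -/

/-- A one-sided bound, up to arbitrarily small errors, of the difference quotients at `0` of the
squared distance along `γ` to points that are `r`-close to `γ 0`. -/
def HasVariationBound {X : Type*} [MetricSpace X] (r C : ℝ) (γ : ℝ → X) : Prop :=
  ∀ x : X, dist x (γ 0) ≤ r → dist (γ 0) (γ 1) ≤ r → ∀ ε : ℝ, 0 < ε → ∃ t ∈ Ioc (0 : ℝ) 1,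
    dist x (γ t) ^ 2 - dist x (γ 0) ^ 2 ≤
      t * (dist x (γ 1) ^ 2 - dist (γ 0) (γ 1) ^ 2 + C * dist x (γ 0) ^ 2 + ε)

theorem IsCAT1.hasVariationBound {X : Type*} [MetricSpace X] (hX : IsCAT1 X) {γ : ℝ → X}
    (hγ : IsMinGeodesic γ) : HasVariationBound 1 10 γ := by
  intro x hx hγ1 ε hε
  -- With this `t` the remainder `20 * t ^ 2` is at most `t * ε`.
  have ht0 : 0 < min 1 (ε / 20) := lt_min one_pos (by positivity)
  have ht1 : min 1 (ε / 20) ≤ 1 := min_le_left _ _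
  have htε : 20 * min 1 (ε / 20) ≤ ε := by linarith [min_le_right 1 (ε / 20)]
  refine ⟨min 1 (ε / 20), ⟨ht0, ht1⟩, ?_⟩
  set t := min 1 (ε / 20)
  have hmem : t ∈ Icc (0 : ℝ) 1 := ⟨ht0.le, ht1⟩
  have g0 : dist (γ t) (γ 0) = t * dist (γ 0) (γ 1) := by
    have := hγ t hmem 0 (by simp)
    rwa [sub_zero, abs_of_nonneg ht0.le] at this
  suffices h : dist x (γ t) ^ 2 - dist x (γ 0) ^ 2 ≤
      t * (dist x (γ 1) ^ 2 - dist (γ 0) (γ 1) ^ 2 + 10 * dist x (γ 0) ^ 2) + 20 * t ^ 2 by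
    nlinarith
  -- The spherical estimate needs sides of positive length, so the degenerate triangles are treated
  -- directly.
  rcases (dist_nonneg (x := x) (y := γ 0)).eq_or_lt with ha | ha
  · rw [eq_comm, dist_eq_zero] at ha
    subst ha
    rw [dist_comm (γ 0) (γ t), g0, dist_self]
    have : dist (γ 0) (γ 1) ^ 2 ≤ 1 := pow_le_one₀ dist_nonneg hγ1
    nlinarith [mul_le_mul_of_nonneg_left this (sq_nonneg t), sq_nonneg t]
  rcases (dist_nonneg (x := γ 0) (y := γ 1)).eq_or_lt with hb | hb
  · rw [← hb, mul_zero] at g0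
    rw [← hb, dist_eq_zero.1 g0, ← dist_eq_zero.1 hb.symm]
    nlinarith [mul_nonneg ht0.le (sq_nonneg (dist x (γ 0))), sq_nonneg t]
  have hpi := Real.pi_gt_three
  refine sq_sub_sq_le_of_cos_ineq ha hx hb hγ1 ?_ ?_ ht0 ht1
    (hX.cos_ineq hγ ?_ hb (by linarith) hmem)
  · exact abs_dist_sub_le x (γ 0) (γ 1)
  · rw [← g0, dist_comm x, dist_comm x]
    exact abs_dist_sub_le _ _ _
  · have := dist_triangle_right (γ 1) x (γ 0)
    rw [dist_comm (γ 1) (γ 0), dist_comm x (γ 0)] at *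
    linarith

/-- Commutativity equates the slope of `d²(x, ·)` along `γ` with the slope of `d²(γ 1, ·)` along a
geodesic `η` from `γ 0` to `x`. The latter is bounded by the `K`-convexity inequality along `η`,
divided by `t`. -/
theorem hasVariationBound_of_isCommutative {X : Type*} [MetricSpace X] {Γ : Set (ℝ → X)} {K : ℝ}
    (hΓ : IsGeodesicFamily Γ) (hcomm : IsCommutative Γ) (hK : SqDistConvexAlong Γ K) {γ : ℝ → X}
    (hγ : γ ∈ Γ) (r : ℝ) : HasVariationBound r (|K| / 2) γ := by
  intro x _ _ ε hε
  obtain ⟨η, hη, hη0, hη1⟩ := hΓ.2 (γ 0) x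
  obtain ⟨L, hL1, hL2⟩ := hcomm γ hγ η hη hη0.symm
  rw [hη1] at hL1
  rw [hη0] at hL2
  have hconv := hK (γ 1) η hη (EReal.coe_ne_top _) (EReal.coe_ne_top _)
  have hlim : L ≤ dist x (γ 1) ^ 2 - dist (γ 0) (γ 1) ^ 2 + |K| / 2 * dist x (γ 0) ^ 2 := by
    refine le_of_tendsto hL2 ?_
    filter_upwards [Ioc_mem_nhdsGT (zero_lt_one' ℝ)] with t ht
    rw [div_le_iff₀ ht.1]
    have h := hconv t ⟨ht.1.le, ht.2⟩
    simp only [EReal.toReal_coe, EReal.coe_le_coe_iff, hη0, hη1] at h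
    rw [dist_comm (η t), dist_comm x (γ 1), dist_comm x (γ 0), dist_comm (γ 0) (γ 1)]
    have h1 : -(K / 2 * ((1 - t) * t) * dist (γ 0) x ^ 2) ≤ |K| / 2 * t * dist (γ 0) x ^ 2 := by
      have hd := sq_nonneg (dist (γ 0) x)
      have : -(K / 2 * ((1 - t) * t)) ≤ |K| / 2 * t := by
        nlinarith [neg_abs_le K, abs_nonneg K, mul_nonneg (sub_nonneg.2 ht.2) ht.1.le,
          mul_nonneg (abs_nonneg K) (sq_nonneg t)]
      nlinarith [mul_le_mul_of_nonneg_right this hd]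
    nlinarith
  have hev := hL1.eventually_lt_const (show L < L + ε by linarith)
  obtain ⟨t, ht, htL⟩ :=
    (Filter.Eventually.and (Ioc_mem_nhdsGT (zero_lt_one' ℝ)) hev).exists
  refine ⟨t, ht, ?_⟩
  rw [div_lt_iff₀ ht.1] at htL
  rw [dist_comm x (γ t), dist_comm x (γ 0)] at *
  nlinarith [mul_le_mul_of_nonneg_left hlim ht.1.le]

/-! ### Proximal points -/

section Prox

variable {X : Type*} [MetricSpace X] {φ : X → EReal} {τ : ℝ} {x z : X}

theorem le_of_mem_proxSet (hz : z ∈ proxSet φ τ x) (w : X) :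
    φ z + ((dist x z ^ 2 / (2 * τ) : ℝ) : EReal) ≤ φ w + ((dist x w ^ 2 / (2 * τ) : ℝ) : EReal) :=
  (show _ = _ from hz).trans_le (iInf_le _ w)

theorem ne_top_of_mem_proxSet (hz : z ∈ proxSet φ τ x) {w : X} (hw : φ w ≠ ⊤) : φ z ≠ ⊤ := by
  intro h
  have := le_of_mem_proxSet hz w
  rw [h, EReal.top_add_coe, top_le_iff] at this
  exact EReal.add_ne_top hw (EReal.coe_ne_top _) this

theorem toReal_le_of_mem_proxSet (hbot : ∀ x, φ x ≠ ⊥) (hz : z ∈ proxSet φ τ x) {w : X}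
    (hw : φ w ≠ ⊤) :
    (φ z).toReal + dist x z ^ 2 / (2 * τ) ≤ (φ w).toReal + dist x w ^ 2 / (2 * τ) := by
  have h := le_of_mem_proxSet hz w
  rw [← EReal.coe_toReal hw (hbot w),
    ← EReal.coe_toReal (ne_top_of_mem_proxSet hz hw) (hbot z)] at h
  exact_mod_cast h

theorem dist_sq_le_of_mem_proxSet (hτ : 0 < τ) (hbot : ∀ x, φ x ≠ ⊥) (hz : z ∈ proxSet φ τ x)
    (hx : φ x ≠ ⊤) : dist x z ^ 2 ≤ 2 * τ * ((φ x).toReal - (φ z).toReal) := by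
  have h := toReal_le_of_mem_proxSet hbot hz hx
  rw [dist_self] at h
  have : dist x z ^ 2 / (2 * τ) ≤ (φ x).toReal - (φ z).toReal := by
    simp only [ne_eq, OfNat.ofNat_ne_zero, not_false_eq_true, zero_pow, zero_div, add_zero] at h
    linarith
  rw [div_le_iff₀ (by positivity)] at this
  linarith

theorem proxSet_nonempty [BoundedSpace X] (hbot : ∀ x, φ x ≠ ⊥) (hlsc : LowerSemicontinuous φ)
    (hcpt : SublevelsCompact φ) (hfin : ∃ y, φ y ≠ ⊤) (hτ : 0 < τ) (x : X) :
    (proxSet φ τ x).Nonempty := by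
  obtain ⟨y, hy⟩ := hfin
  set Q : ℝ := (φ y).toReal + dist x y ^ 2 / (2 * τ) with hQ
  have hyQ : φ y + ((dist x y ^ 2 / (2 * τ) : ℝ) : EReal) = (Q : EReal) := by
    rw [hQ, EReal.coe_add, EReal.coe_toReal hy (hbot y)]
  -- Outside this compact sublevel set `φ` alone already exceeds the value `Q` of the functional at
  -- `y`.
  have hS : IsCompact {w | φ w ≤ (Q : EReal)} := by
    have hcl : IsClosed {w | φ w ≤ (Q : EReal)} := hlsc.isClosed_preimage _
    rw [← hcl.closure_eq]
    exact hcpt Q _ subset_rfl (Bornology.IsBounded.all _)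
  have hnonneg : ∀ w, (0 : EReal) ≤ ((dist x w ^ 2 / (2 * τ) : ℝ) : EReal) := fun w => by
    exact_mod_cast (by positivity : 0 ≤ dist x w ^ 2 / (2 * τ))
  have hyS : y ∈ {w | φ w ≤ (Q : EReal)} := by
    rw [mem_ofPred_eq, ← hyQ]
    exact le_add_of_nonneg_right (hnonneg y)
  have hcont : LowerSemicontinuous
      (fun w => φ w + ((dist x w ^ 2 / (2 * τ) : ℝ) : EReal)) := by
    refine hlsc.add' (Continuous.lowerSemicontinuous ?_) fun w => ?_
    · exact continuous_coe_real_ereal.comp (by fun_prop)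
    · exact EReal.continuousAt_add (Or.inr (EReal.coe_ne_bot _)) (Or.inr (EReal.coe_ne_top _))
  obtain ⟨w, hw, hmin⟩ := hcont.lowerSemicontinuousOn _ |>.exists_isMinOn ⟨y, hyS⟩ hS
  refine ⟨w, le_antisymm (le_iInf fun v => ?_) (iInf_le _ w)⟩
  by_cases hv : v ∈ {w | φ w ≤ (Q : EReal)}
  · exact hmin hv
  · calc _ ≤ φ y + ((dist x y ^ 2 / (2 * τ) : ℝ) : EReal) := hmin hyS
      _ = Q := hyQ
      _ ≤ φ v := (not_le.1 hv).le
      _ ≤ _ := le_add_of_nonneg_right (hnonneg v)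

theorem exists_real_le [BoundedSpace X] (hbot : ∀ x, φ x ≠ ⊥) (hlsc : LowerSemicontinuous φ)
    (hcpt : SublevelsCompact φ) (hfin : ∃ y, φ y ≠ ⊤) : ∃ m : ℝ, ∀ x, (m : EReal) ≤ φ x := by
  obtain ⟨y, hy⟩ := hfin
  obtain ⟨z, hz⟩ := proxSet_nonempty hbot hlsc hcpt ⟨y, hy⟩ one_pos y
  obtain ⟨D, hD⟩ := Metric.isBounded_iff.1 (Bornology.IsBounded.all (univ : Set X))
  refine ⟨(φ z).toReal - D ^ 2 / 2, fun w => ?_⟩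
  by_cases hw : φ w = ⊤
  · rw [hw]; exact le_top
  have h := toReal_le_of_mem_proxSet hbot hz hw
  have h1 : dist y w ^ 2 ≤ D ^ 2 :=
    pow_le_pow_left₀ dist_nonneg (hD (mem_univ _) (mem_univ _)) 2
  rw [← EReal.coe_toReal hw (hbot w), EReal.coe_le_coe_iff]
  nlinarith [sq_nonneg (dist y z)]

end Prox

/-! ### Sums of functions -/

section Sum

variable {X : Type*} [MetricSpace X] {φ₁ φ₂ : X → EReal}

theorem add_ne_bot {Y : Type*} {φ₁ φ₂ : Y → EReal} (h₁ : ∀ x, φ₁ x ≠ ⊥)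
    (h₂ : ∀ x, φ₂ x ≠ ⊥) (x : Y) : φ₁ x + φ₂ x ≠ ⊥ := by
  simp [EReal.add_eq_bot_iff, h₁, h₂]

theorem ne_top_of_add_ne_top {Y : Type*} {φ₁ φ₂ : Y → EReal} (h₁ : ∀ x, φ₁ x ≠ ⊥)
    (h₂ : ∀ x, φ₂ x ≠ ⊥) {x : Y} (hx : φ₁ x + φ₂ x ≠ ⊤) : φ₁ x ≠ ⊤ ∧ φ₂ x ≠ ⊤ := by
  constructor
  · intro h
    exact hx (by rw [h, EReal.top_add_of_ne_bot (h₂ x)])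
  · intro h
    exact hx (by rw [h, EReal.add_top_of_ne_bot (h₁ x)])

theorem lowerSemicontinuous_add (h₁ : ∀ x, φ₁ x ≠ ⊥) (h₂ : ∀ x, φ₂ x ≠ ⊥)
    (hl₁ : LowerSemicontinuous φ₁) (hl₂ : LowerSemicontinuous φ₂) :
    LowerSemicontinuous (fun x => φ₁ x + φ₂ x) :=
  hl₁.add' hl₂ fun x => EReal.continuousAt_add (Or.inr (h₂ x)) (Or.inl (h₁ x))

theorem sublevelsCompact_add (h₁ : ∀ x, φ₁ x ≠ ⊥) (hc₁ : SublevelsCompact φ₁)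
    (hm₂ : ∃ m : ℝ, ∀ x, (m : EReal) ≤ φ₂ x) : SublevelsCompact (fun x => φ₁ x + φ₂ x) := by
  obtain ⟨m, hm⟩ := hm₂
  intro Q S hS hb
  refine hc₁ (Q - m) S (fun x hx => ?_) hb
  have h : φ₁ x + φ₂ x ≤ Q := hS hx
  have h' : φ₁ x + m ≤ Q := (add_le_add_right (hm x) _).trans h
  have hx₁ : φ₁ x ≠ ⊤ := by
    intro e
    rw [e, EReal.top_add_coe, top_le_iff] at h'
    exact EReal.coe_ne_top _ h'
  rw [mem_ofPred_eq]
  rw [← EReal.coe_toReal hx₁ (h₁ x)] at h' ⊢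
  norm_cast at h' ⊢
  linarith

theorem ConvexAlong.add {l₁ l₂ : ℝ} {γ : ℝ → X} (h₁ : ∀ x, φ₁ x ≠ ⊥) (h₂ : ∀ x, φ₂ x ≠ ⊥)
    (h0 : φ₁ (γ 0) + φ₂ (γ 0) ≠ ⊤) (h1 : φ₁ (γ 1) + φ₂ (γ 1) ≠ ⊤)
    (hc₁ : ConvexAlong l₁ φ₁ γ) (hc₂ : ConvexAlong l₂ φ₂ γ) :
    ConvexAlong (l₁ + l₂) (fun x => φ₁ x + φ₂ x) γ := by
  intro t ht
  obtain ⟨a0, b0⟩ := ne_top_of_add_ne_top h₁ h₂ h0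
  obtain ⟨a1, b1⟩ := ne_top_of_add_ne_top h₁ h₂ h1
  refine (add_le_add (hc₁ t ht) (hc₂ t ht)).trans ?_
  rw [EReal.toReal_add a0 (h₁ _) b0 (h₂ _), EReal.toReal_add a1 (h₁ _) b1 (h₂ _),
    ← EReal.coe_add, EReal.coe_le_coe_iff]
  linarith

end Sum

/-! ### Local evolution variational inequalities -/

/-- The discrete evolution variational inequality for proximal points of `ψ`, at points whose
distances are at most `r`. -/
def HasLocalEVI {X : Type*} [MetricSpace X] (ψ : X → EReal) (r C L : ℝ) : Prop :=
  ∀ τ : ℝ, 0 < τ → ∀ x z y : X, z ∈ proxSet ψ τ x → ψ y ≠ ⊤ → dist x z ≤ r → dist z y ≤ r →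
    dist z y ^ 2 ≤ dist x y ^ 2 + C * dist x z ^ 2 +
      2 * τ * ((ψ y).toReal - (ψ z).toReal) + L * τ * dist z y ^ 2

/-- `l`-convexity of `ψ` along curves with the first variation bound that join `r`-close points. -/
def IsLocallyConvex {X : Type*} [MetricSpace X] (ψ : X → EReal) (r C l : ℝ) : Prop :=
  ∀ z y : X, ψ z ≠ ⊤ → ψ y ≠ ⊤ → dist z y ≤ r →
    ∃ γ : ℝ → X, γ 0 = z ∧ γ 1 = y ∧ HasVariationBound r C γ ∧ ConvexAlong l ψ γ

/-- The proximal point `z` is compared with the competitor `γ t`: minimality, convexity of `ψ` and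
the variation bound all carry a factor `t`, which is divided out before `ε` tends to zero. -/
theorem IsLocallyConvex.hasLocalEVI {X : Type*} [MetricSpace X] {ψ : X → EReal} {r C l : ℝ}
    (hbot : ∀ x, ψ x ≠ ⊥) (h : IsLocallyConvex ψ r C l) : HasLocalEVI ψ r C |l| := by
  intro τ hτ x z y hz hy hxz hzy
  have hz' := ne_top_of_mem_proxSet hz hy
  obtain ⟨γ, rfl, rfl, hγ, hconv⟩ := h z y hz' hy hzy
  refine le_of_forall_pos_le_add fun ε hε => ?_
  obtain ⟨t, ht, hvar⟩ := hγ x hxz hzy ε hε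
  have hc := hconv t ⟨ht.1.le, ht.2⟩
  have hγt : ψ (γ t) ≠ ⊤ := fun e => by
    rw [e, top_le_iff] at hc
    exact EReal.coe_ne_top _ hc
  have hm := toReal_le_of_mem_proxSet hbot hz hγt
  rw [← EReal.coe_toReal hγt (hbot _), EReal.coe_le_coe_iff] at hc
  have hm2 : dist x (γ 0) ^ 2 - dist x (γ t) ^ 2 ≤
      2 * τ * ((ψ (γ t)).toReal - (ψ (γ 0)).toReal) := by
    have : dist x (γ 0) ^ 2 / (2 * τ) - dist x (γ t) ^ 2 / (2 * τ) ≤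
        (ψ (γ t)).toReal - (ψ (γ 0)).toReal := by linarith
    rw [← sub_div, div_le_iff₀ (by positivity)] at this
    linarith
  set d := dist (γ 0) (γ 1)
  have hl : -(l / 2 * ((1 - t) * t) * d ^ 2) ≤ |l| / 2 * t * d ^ 2 := by
    refine le_of_eq_of_le (by ring) (mul_le_mul_of_nonneg_right (?_ :
      -(l / 2 * ((1 - t) * t)) ≤ |l| / 2 * t) (sq_nonneg d))
    nlinarith [neg_abs_le l, abs_nonneg l, mul_nonneg (sub_nonneg.2 ht.2) ht.1.le,
      mul_nonneg (abs_nonneg l) (sq_nonneg t)]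
  have hkey : 0 ≤ t * (dist x (γ 1) ^ 2 - d ^ 2 + C * dist x (γ 0) ^ 2 + ε +
      2 * τ * ((ψ (γ 1)).toReal - (ψ (γ 0)).toReal) + |l| * τ * d ^ 2) := by
    have h1 : (ψ (γ t)).toReal - (ψ (γ 0)).toReal ≤
      t * ((ψ (γ 1)).toReal - (ψ (γ 0)).toReal) + |l| / 2 * t * d ^ 2 := by linarith
    have h2 := mul_le_mul_of_nonneg_left h1 (by positivity : 0 ≤ 2 * τ)
    linarith
  have := nonneg_of_mul_nonneg_right hkey ht.1
  linarith

/-! ### Partitions -/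

theorem TimePartition.t_nonneg (P : TimePartition) (k : ℕ) : 0 ≤ P.t k := by
  rw [← P.t_zero]; exact P.strictMono.monotone (Nat.zero_le k)

theorem TimePartition.step_pos (P : TimePartition) (k : ℕ) : 0 < P.step k :=
  sub_pos.2 (P.strictMono (Nat.lt_succ_self k))

theorem TimePartition.t_succ (P : TimePartition) (k : ℕ) : P.t (k + 1) = P.t k + P.step k := by
  rw [TimePartition.step]; ring

theorem TimePartition.t_le_succ (P : TimePartition) (k : ℕ) : P.t k ≤ P.t (k + 1) :=
  P.strictMono.monotone (Nat.le_succ k)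

theorem TimePartition.step_le_of_mesh_lt {P : TimePartition} {m : ℝ} (h : P.mesh < (m : EReal))
    (k : ℕ) : P.step k ≤ m :=
  EReal.coe_le_coe_iff.1 ((le_iSup (fun k : ℕ => ((P.step k : ℝ) : EReal)) k).trans h.le)

theorem TimePartition.exists_lt_abs_sub_le (P : TimePartition) {m s : ℝ}
    (hm : ∀ k, P.step k ≤ m) (hs : 0 ≤ s) {j : ℕ} (hj : s ≤ P.t (j + 1)) :
    ∃ i ≤ j, |P.t i - s| ≤ m ∧ P.t i ≤ s := by
  classical
  have hex : ∃ i, s ≤ P.t (i + 1) := ⟨j, hj⟩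
  refine ⟨Nat.find hex, Nat.find_min' hex hj, ?_⟩
  have hle : P.t (Nat.find hex) ≤ s := by
    rcases h : Nat.find hex with _ | i
    · rw [P.t_zero]; exact hs
    · exact (not_le.1 (Nat.find_min hex (by rw [h]; exact Nat.lt_succ_self i))).le
  refine ⟨?_, hle⟩
  rw [abs_sub_comm, abs_of_nonneg (sub_nonneg.2 hle)]
  have h1 := Nat.find_spec hex
  rw [P.t_succ] at h1
  linarith [hm (Nat.find hex)]

/-! ### Sequences with an approximate evolution variational inequality -/

/-- On `[0, T]` the sequence `z` satisfies the discrete evolution variational inequality of `Φ` at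
`r`-close points of `D`, with the error terms `Λ τ g` where the sums of `g` are at most `M`. -/
structure IsEVISeq {X : Type*} [MetricSpace X] (D : Set X) (Φ : X → ℝ) (r Λ M T m : ℝ)
    (P : TimePartition) (z : ℕ → X) (g : ℕ → ℝ) : Prop where
  step_le : ∀ k, P.step k ≤ m
  mem : ∀ k, P.t k ≤ T → z k ∈ D
  g_nonneg : ∀ k, P.t (k + 1) ≤ T → 0 ≤ g k
  g_sum : ∀ N, P.t N ≤ T → ∑ k ∈ Finset.range N, g k ≤ M
  dist_sq_le : ∀ k, P.t (k + 1) ≤ T → dist (z k) (z (k + 1)) ^ 2 ≤ P.step k * g k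
  evi : ∀ k, P.t (k + 1) ≤ T → ∀ y ∈ D, dist (z (k + 1)) y ≤ r →
    dist (z (k + 1)) y ^ 2 ≤ dist (z k) y ^ 2 + 2 * P.step k * (Φ y - Φ (z (k + 1))) +
      Λ * P.step k * dist (z (k + 1)) y ^ 2 + Λ * P.step k * g k

namespace IsEVISeq

variable {X : Type*} [MetricSpace X] {D : Set X} {Φ : X → ℝ} {r Λ M T m : ℝ}
  {P Q : TimePartition} {z w : ℕ → X} {g f : ℕ → ℝ}

/-- A discrete Cauchy–Schwarz inequality; with bounded sums of `g` it yields Hölder continuity of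
exponent `1/2` in time. -/
theorem dist_sq_le_mul_sum (h : IsEVISeq D Φ r Λ M T m P z g) (i n : ℕ) (hn : P.t (i + n) ≤ T) :
    dist (z i) (z (i + n)) ^ 2 ≤
      (P.t (i + n) - P.t i) * ∑ k ∈ Finset.range n, g (i + k) := by
  induction n with
  | zero => simp
  | succ n ih =>
    rw [← add_assoc] at hn ⊢
    have ht := (P.t_le_succ (i + n)).trans hn
    have h1 := ih ht
    have h2 := h.dist_sq_le (i + n) hn
    have hg := h.g_nonneg (i + n) hn
    have hG : 0 ≤ ∑ k ∈ Finset.range n, g (i + k) := by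
      refine Finset.sum_nonneg fun k hk => h.g_nonneg _ (le_trans ?_ ht)
      exact P.strictMono.monotone (by have := Finset.mem_range.1 hk; omega)
    have hτ := P.step_pos (i + n)
    have hS : 0 ≤ P.t (i + n) - P.t i :=
      sub_nonneg.2 (P.strictMono.monotone (Nat.le_add_right i n))
    rw [Finset.sum_range_succ, P.t_succ]
    set S := P.t (i + n) - P.t i with hSdef
    set G := ∑ k ∈ Finset.range n, g (i + k)
    set τ := P.step (i + n)
    have hST : P.t (i + n) + τ - P.t i = S + τ := by rw [hSdef]; ring
    rw [hST]
    set a := dist (z i) (z (i + n)) with ha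
    set b := dist (z (i + n)) (z (i + n + 1)) with hb
    have htri : dist (z i) (z (i + n + 1)) ≤ a + b := dist_triangle _ _ _
    have hab : 2 * (a * b) ≤ S * g (i + n) + τ * G := by
      refine abs_le_of_sq_le_sq' ?_ (by positivity) |>.2
      have : (a * b) ^ 2 ≤ (S * G) * (τ * g (i + n)) := by
        rw [mul_pow]
        exact mul_le_mul h1 h2 (sq_nonneg _) (by positivity)
      nlinarith [sq_nonneg (S * g (i + n) - τ * G)]
    calc dist (z i) (z (i + n + 1)) ^ 2 ≤ (a + b) ^ 2 := pow_le_pow_left₀ dist_nonneg htri 2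
      _ ≤ (S + τ) * (G + g (i + n)) := by nlinarith

theorem dist_sq_le_mul (h : IsEVISeq D Φ r Λ M T m P z g) {i j : ℕ} (hij : i ≤ j)
    (hj : P.t j ≤ T) : dist (z i) (z j) ^ 2 ≤ M * (P.t j - P.t i) := by
  obtain ⟨n, rfl⟩ := Nat.exists_eq_add_of_le hij
  have hS : 0 ≤ P.t (i + n) - P.t i := sub_nonneg.2 (P.strictMono.monotone hij)
  refine (h.dist_sq_le_mul_sum i n hj).trans ?_
  rw [mul_comm M]
  refine mul_le_mul_of_nonneg_left (le_trans ?_ (h.g_sum _ hj)) hS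
  rw [Finset.sum_range_add]
  refine le_add_of_nonneg_left (Finset.sum_nonneg fun k hk => h.g_nonneg k (le_trans ?_ hj))
  exact P.strictMono.monotone (by have := Finset.mem_range.1 hk; omega)

theorem nonneg (h : IsEVISeq D Φ r Λ M T m P z g) (hT : 0 ≤ T) : 0 ≤ M := by
  simpa using h.g_sum 0 (by rwa [P.t_zero])

theorem sum_error_nonneg (h : IsEVISeq D Φ r Λ M T m P z g) (hΛ : 0 ≤ Λ) {j : ℕ}
    (hj : P.t j ≤ T) : 0 ≤ ∑ i ∈ Finset.range j, Λ * P.step i * g i := by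
  refine Finset.sum_nonneg fun k hk => mul_nonneg (mul_nonneg hΛ (P.step_pos k).le)
    (h.g_nonneg k (le_trans ?_ hj))
  exact P.strictMono.monotone (by have := Finset.mem_range.1 hk; omega)

theorem sum_error_le (h : IsEVISeq D Φ r Λ M T m P z g) (hΛ : 0 ≤ Λ) {j : ℕ}
    (hj : P.t j ≤ T) : ∑ i ∈ Finset.range j, Λ * P.step i * g i ≤ Λ * m * M := by
  have hm : 0 ≤ m := (P.step_pos 0).le.trans (h.step_le 0)
  calc ∑ i ∈ Finset.range j, Λ * P.step i * g i ≤ ∑ i ∈ Finset.range j, Λ * m * g i := by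
        refine Finset.sum_le_sum fun k hk => ?_
        have := h.g_nonneg k (le_trans (P.strictMono.monotone
          (by have := Finset.mem_range.1 hk; omega)) hj)
        exact mul_le_mul_of_nonneg_right (mul_le_mul_of_nonneg_left (h.step_le k) hΛ) this
    _ = Λ * m * ∑ i ∈ Finset.range j, g i := (Finset.mul_sum _ _ _).symm
    _ ≤ Λ * m * M := mul_le_mul_of_nonneg_left (h.g_sum j hj) (by positivity)

end IsEVISeq

/-! ### Comparison by doubling the time variable -/

/-- The majorant of the squared distances, up to an exponential factor. -/
noncomputable def majorant (M ε m t s E F : ℝ) : ℝ :=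
  M * (ε + ((t - s) ^ 2 + m * (t + s)) / ε) + E + F

/-- This is what absorbs the term `2 Λ τ σ` in the coefficient of the doubled inequality; see
`le_of_doubling`. -/
theorem majorant_le_add {M ε m t s E F τ σ e f : ℝ} (hM : 0 ≤ M) (hε : 0 < ε) (hm : 0 ≤ m)
    (hτ : 0 ≤ τ) (hσ : 0 ≤ σ) (ht : 0 ≤ t) (hs : 0 ≤ s) (hE : 0 ≤ E) (hF : 0 ≤ F) :
    majorant M ε m (t + τ) (s + σ) (E + e) (F + f) ≤
      majorant M ε m t (s + σ) E (F + f) + majorant M ε m (t + τ) s (E + e) F := by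
  have h : (t + τ - (s + σ)) ^ 2 + m * (t + τ + (s + σ)) ≤
      ((t - (s + σ)) ^ 2 + m * (t + (s + σ))) + ((t + τ - s) ^ 2 + m * (t + τ + s)) := by
    have h1 : 0 ≤ m * (t + s) := by positivity
    rcases le_total (t + τ) (s + σ) with hle | hle
    · nlinarith [sq_nonneg (t + τ - s), mul_nonneg hτ (sub_nonneg.2 hle)]
    · nlinarith [sq_nonneg (t - (s + σ)), mul_nonneg hσ (sub_nonneg.2 hle)]
  have h2 := mul_le_mul_of_nonneg_left ((div_le_div_iff_of_pos_right hε).2 h) hM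
  rw [add_div ((t - (s + σ)) ^ 2 + m * (t + (s + σ)))] at h2
  have h3 : 0 ≤ M * ε := by positivity
  simp only [majorant]
  linarith

/-- The weighted average of `(t - s) ^ 2` produces an excess `τ σ (τ + σ)`, which the drift `m (t +
s)` compensates by `2 m τ σ`. -/
theorem majorant_recursion {M ε m t s E F τ σ e f : ℝ} (hM : 0 ≤ M) (hε : 0 < ε)
    (hτ : 0 ≤ τ) (hσ : 0 ≤ σ) (hτm : τ ≤ m) (hσm : σ ≤ m) :
    σ * majorant M ε m t (s + σ) E (F + f) + τ * majorant M ε m (t + τ) s (E + e) F +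
      (σ * e + τ * f) ≤ (τ + σ) * majorant M ε m (t + τ) (s + σ) (E + e) (F + f) := by
  have h : σ * ((t - (s + σ)) ^ 2 + m * (t + (s + σ))) +
      τ * ((t + τ - s) ^ 2 + m * (t + τ + s)) ≤
      (τ + σ) * ((t + τ - (s + σ)) ^ 2 + m * (t + τ + (s + σ))) := by
    nlinarith [mul_nonneg (mul_nonneg hτ hσ) (sub_nonneg.2 hτm),
      mul_nonneg (mul_nonneg hτ hσ) (sub_nonneg.2 hσm)]
  have h2 := mul_le_mul_of_nonneg_left ((div_le_div_iff_of_pos_right hε).2 h) hM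
  rw [add_div, mul_div_assoc, mul_div_assoc, mul_div_assoc] at h2
  simp only [majorant]
  linarith

theorem majorant_mono_diag {M ε m t s E F δ S E' : ℝ} (hM : 0 ≤ M) (hε : 0 < ε)
    (hm : 0 ≤ m) (hδ : |t - s| ≤ δ) (ht : t ≤ S) (hs : s ≤ S) (hE : E ≤ E') (hF : F ≤ E') :
    majorant M ε m t s E F ≤ M * (ε + (δ ^ 2 + 2 * m * S) / ε) + 2 * E' := by
  have h1 : (t - s) ^ 2 ≤ δ ^ 2 := sq_le_sq' (abs_le.1 hδ).1 (abs_le.1 hδ).2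
  have h : (t - s) ^ 2 + m * (t + s) ≤ δ ^ 2 + 2 * m * S := by nlinarith
  have h2 := mul_le_mul_of_nonneg_left ((div_le_div_iff_of_pos_right hε).2 h) hM
  simp only [majorant]
  linarith

theorem exp_neg_two_mul_le {x : ℝ} (hx : 0 ≤ x) (hx1 : x ≤ 1 / 2) :
    Real.exp (-(2 * x)) ≤ 1 - x := by
  rw [Real.exp_neg, inv_le_iff_one_le_mul₀ (Real.exp_pos _)]
  nlinarith [Real.add_one_le_exp (2 * x)]

namespace IsEVISeq

variable {X : Type*} [MetricSpace X] {D : Set X} {Φ : X → ℝ} {r Λ M T m : ℝ}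
  {P Q : TimePartition} {z w : ℕ → X} {g f : ℕ → ℝ}

/-- Adding the two variational inequalities with weights eliminates `Φ`. -/
theorem doubling (hz : IsEVISeq D Φ r Λ M T m P z g) (hw : IsEVISeq D Φ r Λ M T m Q w f)
    {j k : ℕ} (hj : P.t (j + 1) ≤ T) (hk : Q.t (k + 1) ≤ T)
    (hr : dist (z (j + 1)) (w (k + 1)) ≤ r) :
    (P.step j + Q.step k - 2 * Λ * P.step j * Q.step k) * dist (z (j + 1)) (w (k + 1)) ^ 2 ≤
      Q.step k * dist (z j) (w (k + 1)) ^ 2 + P.step j * dist (z (j + 1)) (w k) ^ 2 +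
        (Q.step k * (Λ * P.step j * g j) + P.step j * (Λ * Q.step k * f k)) := by
  have h1 := hz.evi j hj _ (hw.mem _ hk) hr
  have h2 := hw.evi k hk _ (hz.mem _ hj) (by rwa [dist_comm])
  rw [dist_comm (w (k + 1)), dist_comm (w k)] at h2
  have h3 := mul_le_mul_of_nonneg_left h1 (Q.step_pos k).le
  have h4 := mul_le_mul_of_nonneg_left h2 (P.step_pos j).le
  linarith

/-- Boundary values of the recursion: Hölder continuity bounds the left side by `M * Q.t k`, and `t
≤ ε + t ^ 2 / ε`. -/
theorem dist_sq_zero_le (hw : IsEVISeq D Φ r Λ M T m Q w f) (hM : 0 ≤ M) {ε : ℝ} (hε : 0 < ε)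
    {k : ℕ} (hk : Q.t k ≤ T) : dist (w 0) (w k) ^ 2 ≤ M * (ε + (Q.t k ^ 2 + m * Q.t k) / ε) := by
  have hm : 0 ≤ m := (Q.step_pos 0).le.trans (hw.step_le 0)
  have h := hw.dist_sq_le_mul (Nat.zero_le k) hk
  rw [Q.t_zero, sub_zero] at h
  refine h.trans (mul_le_mul_of_nonneg_left ?_ hM)
  rw [← sub_le_iff_le_add', le_div_iff₀ hε]
  nlinarith [mul_nonneg hm (Q.t_nonneg k), sq_nonneg (Q.t k - ε), sq_nonneg ε, sq_nonneg (Q.t k)]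

/-- An earlier `z i` at nearly the time of `w k` is within `r / 2` of `w k` by hypothesis, and `z`
moves at most `r / 2` from there by Hölder continuity. This licenses the use of the local EVI. -/
theorem dist_le_of_diagonal (hz : IsEVISeq D Φ r Λ M T m P z g)
    (hr : 0 ≤ r) (hM : 0 ≤ M) {h : ℝ} (hh : M * (h + m) ≤ (r / 2) ^ 2) {j k : ℕ}
    (hj : P.t (j + 1) ≤ T) (hle : Q.t k ≤ P.t (j + 1)) (hnear : P.t (j + 1) - Q.t k ≤ h)
    (hdiag : ∀ i ≤ j, |P.t i - Q.t k| ≤ m → dist (z i) (w k) ^ 2 ≤ (r / 2) ^ 2) :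
    dist (z (j + 1)) (w k) ≤ r := by
  obtain ⟨i, hij, hi, -⟩ := P.exists_lt_abs_sub_le hz.step_le (Q.t_nonneg k) hle
  have h1 : dist (z i) (w k) ≤ r / 2 :=
    abs_le_of_sq_le_sq' (hdiag i hij hi) (by positivity) |>.2
  have h2 : dist (z i) (z (j + 1)) ≤ r / 2 := by
    refine abs_le_of_sq_le_sq' (le_trans ?_ hh) (by positivity) |>.2
    refine (hz.dist_sq_le_mul (hij.trans (Nat.le_succ j)) hj).trans
      (mul_le_mul_of_nonneg_left ?_ hM)
    linarith [(abs_le.1 hi).1]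
  have := dist_triangle_left (z (j + 1)) (w k) (z i)
  linarith

theorem le_of_doubling {Λ τ σ A A₁ A₂ B B₁ B₂ p p₁ p₂ q : ℝ} (hΛ : 0 ≤ Λ) (hτ : 0 < τ)
    (hσ : 0 < σ) (hp : 1 ≤ p) (hΛτ : 2 * Λ * τ ≤ 1 / 2) (hq : 0 ≤ q) (hB₁ : 0 ≤ B₁)
    (hB₂ : 0 ≤ B₂) (h₁ : A₁ ≤ p₁ * B₁) (h₂ : A₂ ≤ p₂ * B₂) (hp₁ : p₁ ≤ p * (1 - 2 * Λ * τ))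
    (hp₂ : p₂ ≤ p * (1 - 2 * Λ * σ)) (hrec : σ * B₁ + τ * B₂ + q ≤ (τ + σ) * B)
    (hadd : B ≤ B₁ + B₂) (h : (τ + σ - 2 * Λ * τ * σ) * A ≤ σ * A₁ + τ * A₂ + q) :
    A ≤ p * B := by
  have y1 : σ * A₁ ≤ σ * (p * (1 - 2 * Λ * τ) * B₁) :=
    mul_le_mul_of_nonneg_left (h₁.trans (mul_le_mul_of_nonneg_right hp₁ hB₁)) hσ.le
  have y2 : τ * A₂ ≤ τ * (p * (1 - 2 * Λ * σ) * B₂) :=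
    mul_le_mul_of_nonneg_left (h₂.trans (mul_le_mul_of_nonneg_right hp₂ hB₂)) hτ.le
  have y3 : q ≤ p * q := le_mul_of_one_le_left hq hp
  have y4 := mul_le_mul_of_nonneg_left hrec (zero_le_one.trans hp)
  have y5 := mul_le_mul_of_nonneg_left hadd (by positivity : 0 ≤ p * (2 * Λ * τ * σ))
  have hpos : 0 < τ + σ - 2 * Λ * τ * σ := by nlinarith
  refine le_of_mul_le_mul_left ?_ hpos
  linarith

theorem exp_mul_majorant_le (hz : IsEVISeq D Φ r Λ M T m P z g)
    (hw : IsEVISeq D Φ r Λ M T m Q w f) (hΛ : 0 ≤ Λ) (hT : 0 ≤ T) {ε : ℝ} (hε : 0 < ε) {j k : ℕ}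
    (hjk : |P.t j - Q.t k| ≤ m) (hj : P.t j ≤ T) (hk : Q.t k ≤ T) :
    Real.exp (4 * Λ * (P.t j + Q.t k)) *
      majorant M ε m (P.t j) (Q.t k) (∑ i ∈ Finset.range j, Λ * P.step i * g i)
        (∑ i ∈ Finset.range k, Λ * Q.step i * f i) ≤
      Real.exp (8 * Λ * T) * (M * (ε + (m ^ 2 + 2 * m * T) / ε) + 2 * (Λ * m * M)) := by
  have hM := hz.nonneg hT
  have hm : 0 ≤ m := (P.step_pos 0).le.trans (hz.step_le 0)
  have h1 := P.t_nonneg j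
  have h2 := Q.t_nonneg k
  refine mul_le_mul (Real.exp_le_exp.2 ?_) (majorant_mono_diag hM hε hm hjk hj hk
    (hz.sum_error_le hΛ hj) (hw.sum_error_le hΛ hk)) ?_ (Real.exp_pos _).le
  · nlinarith [mul_nonneg hΛ (sub_nonneg.2 hj), mul_nonneg hΛ (sub_nonneg.2 hk)]
  · have h3 := hz.sum_error_nonneg hΛ hj
    have h4 := hw.sum_error_nonneg hΛ hk
    rw [majorant]; positivity

/-- Induction on `j + k`. The EVI may be used only once the two points are known to be `r`-close, so
the induction hypothesis serves twice: for that closeness and for the recursion itself. -/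
theorem dist_sq_le_majorant (hz : IsEVISeq D Φ r Λ M T m P z g)
    (hw : IsEVISeq D Φ r Λ M T m Q w f) (h0 : z 0 = w 0) (hr : 0 ≤ r) (hΛ : 0 ≤ Λ) (hT : 0 ≤ T)
    {R ε h : ℝ} (hε : 0 < ε) (hh0 : 0 ≤ h) (hR : ∀ x y : X, dist x y ^ 2 ≤ R)
    (hRε : R * ε ≤ M * h ^ 2)
    (hΛm : 2 * Λ * m ≤ 1 / 2) (hh : M * (h + m) ≤ (r / 2) ^ 2)
    (hdiag : Real.exp (8 * Λ * T) * (M * (ε + (m ^ 2 + 2 * m * T) / ε) + 2 * (Λ * m * M)) ≤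
      (r / 2) ^ 2) (j k : ℕ) (hj : P.t j ≤ T) (hk : Q.t k ≤ T) :
    dist (z j) (w k) ^ 2 ≤ Real.exp (4 * Λ * (P.t j + Q.t k)) *
      majorant M ε m (P.t j) (Q.t k) (∑ i ∈ Finset.range j, Λ * P.step i * g i)
        (∑ i ∈ Finset.range k, Λ * Q.step i * f i) := by
  have hM := hz.nonneg hT
  have hm : 0 ≤ m := (P.step_pos 0).le.trans (hz.step_le 0)
  induction hn : j + k using Nat.strong_induction_on generalizing j k with
  | _ n ih =>
  have hmaj : ∀ j k, P.t j ≤ T → Q.t k ≤ T →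
      M * (ε + ((P.t j - Q.t k) ^ 2 + m * (P.t j + Q.t k)) / ε) ≤
      Real.exp (4 * Λ * (P.t j + Q.t k)) *
      majorant M ε m (P.t j) (Q.t k) (∑ i ∈ Finset.range j, Λ * P.step i * g i)
        (∑ i ∈ Finset.range k, Λ * Q.step i * f i) := by
    intro j k hj hk
    have h1 := P.t_nonneg j
    have h2 := Q.t_nonneg k
    have h3 := hz.sum_error_nonneg hΛ hj
    have h4 := hw.sum_error_nonneg hΛ hk
    refine le_trans ?_ (le_mul_of_one_le_left ?_ (Real.one_le_exp (by positivity)))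
    · rw [majorant]; linarith
    · rw [majorant]; positivity
  rcases j with _ | j
  · rw [h0]
    refine (hw.dist_sq_zero_le hM hε hk).trans ((hmaj 0 k hj hk).trans' (le_of_eq ?_))
    rw [P.t_zero]; ring_nf
  rcases k with _ | k
  · rw [← h0, dist_comm]
    refine (hz.dist_sq_zero_le hM hε hj).trans ((hmaj (j + 1) 0 hj hk).trans' (le_of_eq ?_))
    rw [Q.t_zero]; ring_nf
  have hj' := (P.t_le_succ j).trans hj
  have hk' := (Q.t_le_succ k).trans hk
  have hPj := P.t_nonneg (j + 1)
  have hQk := Q.t_nonneg (k + 1)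
  -- At times at least `h` apart, `ε` is so small that the majorant exceeds the squared diameter
  -- bound `R`.
  by_cases hfar : h ≤ |P.t (j + 1) - Q.t (k + 1)|
  · refine (hR _ _).trans ((hmaj _ _ hj hk).trans' ?_)
    have h1 : h ^ 2 ≤ (P.t (j + 1) - Q.t (k + 1)) ^ 2 := by
      rw [← sq_abs (P.t (j + 1) - _)]
      exact pow_le_pow_left₀ hh0 hfar 2
    have h2 : M * h ^ 2 ≤
        M * ((P.t (j + 1) - Q.t (k + 1)) ^ 2 + m * (P.t (j + 1) + Q.t (k + 1))) :=
      mul_le_mul_of_nonneg_left (by nlinarith) hM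
    have h3 : R ≤ M * ((P.t (j + 1) - Q.t (k + 1)) ^ 2 + m * (P.t (j + 1) + Q.t (k + 1))) / ε := by
      rw [le_div_iff₀ hε]; exact hRε.trans h2
    rw [mul_add, ← mul_div_assoc]
    linarith [mul_nonneg hM hε.le]
  push Not at hfar
  have hdiag' : ∀ i l, P.t i ≤ T → Q.t l ≤ T → i + l < n → |P.t i - Q.t l| ≤ m →
      dist (z i) (w l) ^ 2 ≤ (r / 2) ^ 2 := by
    intro i l hi hl hil hm'
    refine (ih _ hil i l hi hl rfl).trans (le_trans ?_ hdiag)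
    exact hz.exp_mul_majorant_le hw hΛ hT hε hm' hi hl
  have hnear : dist (z (j + 1)) (w (k + 1)) ≤ r := by
    rcases le_total (Q.t (k + 1)) (P.t (j + 1)) with hle | hle
    · refine hz.dist_le_of_diagonal hr hM hh hj hle (abs_lt.1 hfar).2.le fun i hi him => ?_
      exact hdiag' i (k + 1) ((P.strictMono.monotone (by omega)).trans hj) hk (by omega) him
    · rw [dist_comm]
      refine hw.dist_le_of_diagonal hr hM hh hk hle (by linarith [(abs_lt.1 hfar).1])
        fun i hi him => ?_
      rw [dist_comm]
      exact hdiag' (j + 1) i hj ((Q.strictMono.monotone (by omega)).trans hk) (by omega)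
        (by rwa [abs_sub_comm])
  have key := hz.doubling hw hj hk hnear
  have i1 := ih (j + (k + 1)) (by omega) j (k + 1) hj' hk rfl
  have i2 := ih (j + 1 + k) (by omega) (j + 1) k hj hk' rfl
  have hτ := P.step_pos j
  have hσ := Q.step_pos k
  have hτm := hz.step_le j
  have hσm := hw.step_le k
  have hg := hz.g_nonneg j hj
  have hf := hw.g_nonneg k hk
  have hE := hz.sum_error_nonneg hΛ hj'
  have hF := hw.sum_error_nonneg hΛ hk'
  have ht := P.t_nonneg j
  have hs := Q.t_nonneg k
  rw [Finset.sum_range_succ, Finset.sum_range_succ]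
  rw [Finset.sum_range_succ] at i1 i2
  rw [P.t_succ j] at i2 ⊢
  rw [Q.t_succ k] at i1 ⊢
  set τ := P.step j
  set σ := Q.step k
  set t := P.t j
  set s := Q.t k
  set E := ∑ i ∈ Finset.range j, Λ * P.step i * g i
  set F := ∑ i ∈ Finset.range k, Λ * Q.step i * f i
  have hΛτ : 2 * Λ * τ ≤ 1 / 2 := (mul_le_mul_of_nonneg_left hτm (by positivity)).trans hΛm
  have hΛσ : 2 * Λ * σ ≤ 1 / 2 := (mul_le_mul_of_nonneg_left hσm (by positivity)).trans hΛm
  have he : 0 ≤ Λ * τ * g j := by positivity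
  have hf' : 0 ≤ Λ * σ * f k := by positivity
  set e := Λ * τ * g j
  set e' := Λ * σ * f k
  have hrec := majorant_recursion (t := t) (s := s) (E := E) (F := F) (e := e) (f := e') hM hε
    hτ.le hσ.le hτm hσm
  have hadd := majorant_le_add (e := e) (f := e') hM hε hm hτ.le hσ.le ht hs hE hF
  have hB1 : 0 ≤ majorant M ε m t (s + σ) E (F + e') := by rw [majorant]; positivity
  have hB2 : 0 ≤ majorant M ε m (t + τ) s (E + e) F := by rw [majorant]; positivity
  have hp : 1 ≤ Real.exp (4 * Λ * (t + τ + (s + σ))) := Real.one_le_exp (by positivity)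
  -- The exponent `4 Λ` is twice the rate `2 Λ` since `1 - x` is bounded below by `exp (-2x)`, not
  -- by `exp (-x)`.
  have x1 : Real.exp (4 * Λ * (t + (s + σ))) ≤
      Real.exp (4 * Λ * (t + τ + (s + σ))) * (1 - 2 * Λ * τ) := by
    have : 4 * Λ * (t + (s + σ)) = 4 * Λ * (t + τ + (s + σ)) + -(2 * (2 * Λ * τ)) := by ring
    rw [this, Real.exp_add]
    exact mul_le_mul_of_nonneg_left (exp_neg_two_mul_le (by positivity) hΛτ)
      (Real.exp_pos _).le
  have x2 : Real.exp (4 * Λ * (t + τ + s)) ≤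
      Real.exp (4 * Λ * (t + τ + (s + σ))) * (1 - 2 * Λ * σ) := by
    have : 4 * Λ * (t + τ + s) = 4 * Λ * (t + τ + (s + σ)) + -(2 * (2 * Λ * σ)) := by ring
    rw [this, Real.exp_add]
    exact mul_le_mul_of_nonneg_left (exp_neg_two_mul_le (by positivity) hΛσ)
      (Real.exp_pos _).le
  exact le_of_doubling hΛ hτ hσ hp hΛτ (by positivity) hB1 hB2 i1 i2 x1 x2 hrec hadd key

end IsEVISeq

/-- Any two sequences with the approximate evolution variational inequality and the same initial
point are uniformly close at nearby times if the steps are small. -/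
theorem IsEVISeq.exists_dist_le {X : Type*} [MetricSpace X] [BoundedSpace X] (D : Set X)
    (Φ : X → ℝ) {r Λ M T : ℝ} (hr : 0 < r) (hΛ : 0 ≤ Λ) (hM : 0 < M) (hT : 0 ≤ T) {ρ : ℝ}
    (hρ : 0 < ρ) :
    ∃ η : ℝ, 0 < η ∧ ∀ m ≤ η, ∀ (P Q : TimePartition) (z w : ℕ → X) (g f : ℕ → ℝ),
      IsEVISeq D Φ r Λ M T m P z g → IsEVISeq D Φ r Λ M T m Q w f → z 0 = w 0 →
      ∀ j k, P.t j ≤ T → Q.t k ≤ T → |P.t j - Q.t k| ≤ m → dist (z j) (w k) ≤ ρ := by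
  obtain ⟨d, hd⟩ := Metric.isBounded_iff.1 (Bornology.IsBounded.all (univ : Set X))
  have hR : ∀ x y : X, dist x y ^ 2 ≤ d ^ 2 := fun x y =>
    pow_le_pow_left₀ dist_nonneg (hd (mem_univ _) (mem_univ _)) 2
  -- The order of choices matters: `h` depends on `r` and `M`, then `ε` on `h` and `ρ`, and the mesh
  -- bound comes last. The value makes `M * (h + m) ≤ (r / 2) ^ 2` once `m < h`.
  set h := r ^ 2 / (8 * M) with hh
  have hh0 : 0 < h := by positivity
  have hMh : M * h = r ^ 2 / 8 := by rw [hh]; field_simp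
  set κ := Real.exp (8 * Λ * T) with hκ
  have hκ0 : 0 < κ := Real.exp_pos _
  -- Capping at `r / 2` lets one smallness condition give both the conclusion and the closeness near
  -- the diagonal.
  set ρ' := min ρ (r / 2) with hρ'
  have hρ'0 : 0 < ρ' := lt_min hρ (by positivity)
  set ε := min (M * h ^ 2 / (d ^ 2 + 1)) (ρ' ^ 2 / (2 * (κ * M))) with hε
  have hε0 : 0 < ε := lt_min (by positivity) (by positivity)
  have hε1 : d ^ 2 * ε ≤ M * h ^ 2 := by
    have := min_le_left (M * h ^ 2 / (d ^ 2 + 1)) (ρ' ^ 2 / (2 * (κ * M)))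
    rw [← hε, le_div_iff₀ (by positivity)] at this
    linarith
  have hε2 : κ * (M * ε) < ρ' ^ 2 := by
    have := min_le_right (M * h ^ 2 / (d ^ 2 + 1)) (ρ' ^ 2 / (2 * (κ * M)))
    rw [← hε, le_div_iff₀ (by positivity)] at this
    have : 0 < ρ' ^ 2 := by positivity
    linarith
  have e1 : ∀ᶠ m in 𝓝 (0 : ℝ),
      κ * (M * (ε + (m ^ 2 + 2 * m * T) / ε) + 2 * (Λ * m * M)) < ρ' ^ 2 := by
    have hc : Continuous fun m : ℝ =>
        κ * (M * (ε + (m ^ 2 + 2 * m * T) / ε) + 2 * (Λ * m * M)) := by fun_prop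
    refine (hc.tendsto 0).eventually_lt_const ?_
    simpa using hε2
  have e2 : ∀ᶠ m in 𝓝 (0 : ℝ), 2 * Λ * m < 1 / 2 := by
    have hc : Continuous fun m : ℝ => 2 * Λ * m := by fun_prop
    exact (hc.tendsto 0).eventually_lt_const (by norm_num)
  obtain ⟨δ, hδ, hball⟩ := Metric.eventually_nhds_iff.1
    ((e1.and e2).and (eventually_lt_nhds hh0))
  refine ⟨δ / 2, by positivity, fun m hmη P Q z w g f hz hw h0 j k hj hk hjk => ?_⟩
  have hm : 0 ≤ m := (P.step_pos 0).le.trans (hz.step_le 0)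
  obtain ⟨⟨c1, c2⟩, c3⟩ := hball (y := m)
    (by rw [Real.dist_eq, sub_zero, abs_of_nonneg hm]; linarith)
  have hρr : ρ' ^ 2 ≤ (r / 2) ^ 2 := pow_le_pow_left₀ hρ'0.le (min_le_right _ _) 2
  have hfin := (hz.dist_sq_le_majorant hw h0 hr.le hΛ hT hε0 hh0.le hR hε1 c2.le
    (by nlinarith) (c1.le.trans hρr) j k hj hk).trans
      (hz.exp_mul_majorant_le hw hΛ hT hε0 hjk hj hk)
  exact (abs_le_of_sq_le_sq' (hfin.trans c1.le) hρ'0.le).2.trans (min_le_left _ _)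

/-! ### Interpolated curves -/

theorem interp_eq (P : TimePartition) {X : Type*} (x : ℕ → X) {m t : ℝ}
    (hm : ∀ k, P.step k ≤ m) (ht : 0 ≤ t) :
    ∃ k, interp P x t = x k ∧ t ≤ P.t k ∧ P.t k ≤ t + m := by
  have hne : {k : ℕ | t ≤ P.t k}.Nonempty := (P.tendsto.eventually_ge_atTop t).exists
  refine ⟨_, rfl, Nat.sInf_mem hne, ?_⟩
  rcases h : sInf {k : ℕ | t ≤ P.t k} with _ | j
  · rw [P.t_zero]
    have := (P.step_pos 0).le.trans (hm 0)
    linarith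
  · have hj : j ∉ {k : ℕ | t ≤ P.t k} := Nat.notMem_of_lt_sInf (by omega)
    have hj' : P.t j < t := not_le.1 hj
    rw [P.t_succ]
    linarith [hm j]

/-! ### Discrete solutions -/

section Discrete

variable {X : Type*} [MetricSpace X] {φ : X → EReal} {P : TimePartition} {x₀ : X} {x : ℕ → X}

theorem IsDiscreteSolution.ne_top (hx : IsDiscreteSolution φ P x₀ x) (h₀ : φ x₀ ≠ ⊤) (k : ℕ) :
    φ (x k) ≠ ⊤ := by
  induction k with
  | zero => rwa [hx.1]
  | succ k ih => exact ne_top_of_mem_proxSet (hx.2 k) ih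

/-- The dissipation `g` telescopes, so its sums are controlled by the initial energy and the lower
bound `b`. The condition on `m * M` keeps every single step shorter than the radius of the local
EVI. -/
theorem IsDiscreteSolution.isEVISeq {r C L Λ M m b : ℝ} (T : ℝ) (hbot : ∀ x, φ x ≠ ⊥)
    (hevi : HasLocalEVI φ r C L) (hr : 0 ≤ r) (hb : ∀ x, (b : EReal) ≤ φ x) (h₀ : φ x₀ ≠ ⊤)
    (hΛC : C ≤ Λ) (hΛL : L ≤ Λ) (hΛ : 0 ≤ Λ) (hM : 2 * ((φ x₀).toReal - b) ≤ M)
    (hmM : m * M ≤ r ^ 2) (hm : ∀ k, P.step k ≤ m) (hx : IsDiscreteSolution φ P x₀ x) :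
    IsEVISeq {y | φ y ≠ ⊤} (fun y => (φ y).toReal) r Λ M T m P x
      (fun k => 2 * ((φ (x k)).toReal - (φ (x (k + 1))).toReal)) := by
  have hm0 : 0 ≤ m := (P.step_pos 0).le.trans (hm 0)
  have hfin := hx.ne_top h₀
  have hd : ∀ k, dist (x k) (x (k + 1)) ^ 2 ≤
      P.step k * (2 * ((φ (x k)).toReal - (φ (x (k + 1))).toReal)) := fun k => by
    have := dist_sq_le_of_mem_proxSet (P.step_pos k) hbot (hx.2 k) (hfin k)
    linarith
  have hg : ∀ k, 0 ≤ 2 * ((φ (x k)).toReal - (φ (x (k + 1))).toReal) := fun k =>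
    nonneg_of_mul_nonneg_right ((sq_nonneg _).trans (hd k)) (P.step_pos k)
  have hsum : ∀ N, ∑ k ∈ Finset.range N, 2 * ((φ (x k)).toReal - (φ (x (k + 1))).toReal) ≤ M := by
    intro N
    rw [← Finset.mul_sum, Finset.sum_range_sub', hx.1]
    have := hb (x N)
    rw [← EReal.coe_toReal (hfin N) (hbot _), EReal.coe_le_coe_iff] at this
    linarith
  refine ⟨hm, fun k _ => hfin k, fun k _ => hg k, fun N _ => hsum N, fun k _ => hd k,
    fun k _ y hy hyr => ?_⟩
  have hgM : 2 * ((φ (x k)).toReal - (φ (x (k + 1))).toReal) ≤ M :=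
    (Finset.single_le_sum (fun i _ => hg i) (Finset.self_mem_range_succ k)).trans (hsum (k + 1))
  have hxr : dist (x k) (x (k + 1)) ≤ r :=
    (abs_le_of_sq_le_sq' ((hd k).trans ((mul_le_mul (hm k) hgM (hg k) hm0).trans hmM)) hr).2
  have h := hevi _ (P.step_pos k) _ _ y (hx.2 k) hy hxr hyr
  have h1 : C * dist (x k) (x (k + 1)) ^ 2 ≤ Λ * P.step k *
      (2 * ((φ (x k)).toReal - (φ (x (k + 1))).toReal)) := by
    rw [mul_assoc]
    exact mul_le_mul hΛC (hd k) (sq_nonneg _) hΛ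
  have h2 : L * P.step k * dist (x (k + 1)) y ^ 2 ≤ Λ * P.step k * dist (x (k + 1)) y ^ 2 :=
    mul_le_mul_of_nonneg_right (mul_le_mul_of_nonneg_right hΛL (P.step_pos k).le) (sq_nonneg _)
  linarith

theorem exists_isDiscreteSolution (h : ∀ τ, 0 < τ → ∀ x, (proxSet φ τ x).Nonempty)
    (P : TimePartition) (x₀ : X) : ∃ x, IsDiscreteSolution φ P x₀ x := by
  choose J hJ using fun k x => h (P.step k) (P.step_pos k) x
  exact ⟨fun k => Nat.rec x₀ J k, rfl, fun k => hJ k _⟩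

end Discrete

/-! ### Solutions of the alternating scheme -/

theorem ereal_coe_sum {ι : Type*} (s : Finset ι) (f : ι → ℝ) :
    ((∑ i ∈ s, f i : ℝ) : EReal) = ∑ i ∈ s, (f i : EReal) := by
  classical
  induction s using Finset.induction_on with
  | empty => simp
  | insert a s ha ih => rw [Finset.sum_insert ha, Finset.sum_insert ha, EReal.coe_add, ih]

theorem ne_top_of_sub_ne_top {a b : EReal} (hb : b ≠ ⊤) (h : a - b ≠ ⊤) : a ≠ ⊤ := by
  rintro rfl
  rw [sub_eq_add_neg, EReal.top_add_of_ne_bot (by simpa using hb)] at h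
  exact h rfl

theorem increment_nonneg {X : Type*} (φ₁ φ₂ : X → EReal) (zh z : ℕ → X) (k : ℕ) :
    0 ≤ increment φ₁ φ₂ zh z k := le_max_left _ _

section Split

variable {X : Type*} [MetricSpace X] {φ₁ φ₂ : X → EReal} {P : TimePartition} {z₀ : X}
  {zh z : ℕ → X}

theorem exists_isSplitSolution (h₁ : ∀ τ, 0 < τ → ∀ x, (proxSet φ₁ τ x).Nonempty)
    (h₂ : ∀ τ, 0 < τ → ∀ x, (proxSet φ₂ τ x).Nonempty) (P : TimePartition) (z₀ : X) :
    ∃ zh z, IsSplitSolution φ₁ φ₂ P z₀ zh z := by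
  choose J hJ using fun k x => h₁ (P.step k) (P.step_pos k) x
  choose I hI using fun k x => h₂ (P.step k) (P.step_pos k) x
  let z : ℕ → X := fun k => Nat.rec z₀ (fun k x => I k (J k x)) k
  -- The truncated subtraction matters only at the unused index `0`.
  exact ⟨fun k => J (k - 1) (z (k - 1)), z, rfl, fun k => ⟨hJ k _, hI k _⟩⟩

/-- The increments are finite as long as their sums are bounded. -/
theorem increment_ne_top {Y : Type*} {φ₁ φ₂ : Y → EReal} {zh z : ℕ → Y} {N : ℕ} {Δ : ℝ}
    (h : ∑ k ∈ Finset.range N, increment φ₁ φ₂ zh z k ≤ (Δ : EReal)) {k : ℕ} (hk : k < N) :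
    increment φ₁ φ₂ zh z k ≠ ⊤ := by
  have := (Finset.single_le_sum (fun i _ => increment_nonneg φ₁ φ₂ zh z i)
    (Finset.mem_range.2 hk)).trans h
  exact ne_top_of_le_ne_top (EReal.coe_ne_top _) this

theorem IsSplitSolution.ne_top_succ (h : IsSplitSolution φ₁ φ₂ P z₀ zh z) {k : ℕ}
    (hk : increment φ₁ φ₂ zh z k ≠ ⊤) (h₁ : φ₁ (z k) ≠ ⊤) (h₂ : φ₂ (z k) ≠ ⊤) :
    φ₁ (zh (k + 1)) ≠ ⊤ ∧ φ₂ (zh (k + 1)) ≠ ⊤ ∧ φ₁ (z (k + 1)) ≠ ⊤ ∧ φ₂ (z (k + 1)) ≠ ⊤ := by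
  have a₁ := ne_top_of_mem_proxSet (h.2 k).1 h₁
  have a₂ : φ₂ (zh (k + 1)) ≠ ⊤ := ne_top_of_sub_ne_top h₂ (ne_top_of_le_ne_top hk
    ((le_max_left _ _).trans (le_max_right _ _)))
  exact ⟨a₁, a₂, ne_top_of_sub_ne_top a₁ (ne_top_of_le_ne_top hk
    ((le_max_right _ _).trans (le_max_right _ _))), ne_top_of_mem_proxSet (h.2 k).2 a₂⟩

theorem IsSplitSolution.ne_top (h : IsSplitSolution φ₁ φ₂ P z₀ zh z) {N : ℕ}
    (hN : ∀ k < N, increment φ₁ φ₂ zh z k ≠ ⊤) (h₁ : φ₁ z₀ ≠ ⊤) (h₂ : φ₂ z₀ ≠ ⊤) :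
    φ₁ (z N) ≠ ⊤ ∧ φ₂ (z N) ≠ ⊤ := by
  induction N with
  | zero => rw [h.1]; exact ⟨h₁, h₂⟩
  | succ N ih =>
    obtain ⟨a, b⟩ := ih fun k hk => hN k (hk.trans (Nat.lt_succ_self N))
    exact (h.ne_top_succ (hN N (Nat.lt_succ_self N)) a b).2.2

theorem toReal_sub_le {a b c : EReal} (ha : a ≠ ⊤) (ha' : a ≠ ⊥) (hb : b ≠ ⊤) (hb' : b ≠ ⊥)
    (hc : c ≠ ⊤) (h : a - b ≤ c) : a.toReal - b.toReal ≤ c.toReal := by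
  lift a to ℝ using ⟨ha, ha'⟩
  lift b to ℝ using ⟨hb, hb'⟩
  have hc' : c ≠ ⊥ := ne_bot_of_le_ne_bot (EReal.coe_ne_bot (a - b)) (by exact_mod_cast h)
  lift c to ℝ using ⟨hc, hc'⟩
  simp only [EReal.toReal_coe]
  exact_mod_cast h

/-- One step of the alternating scheme: energy dissipation and variational inequality. Here
`p`, `h`, `w` are the values before, in the middle of and after the step. -/
theorem split_step {r C L₁ L₂ Λ τ δ : ℝ} {p h w : X} (hb₁ : ∀ x, φ₁ x ≠ ⊥) (hb₂ : ∀ x, φ₂ x ≠ ⊥)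
    (he₁ : HasLocalEVI φ₁ r C L₁) (he₂ : HasLocalEVI φ₂ r C L₂)
    (hL₁ : 0 ≤ L₁) (hL₂ : 0 ≤ L₂) (hC : 0 ≤ C) (hΛ : C + 1 + 2 * L₁ + L₂ ≤ Λ)
    (hτ : 0 < τ) (hτ1 : τ ≤ 1) (hh : h ∈ proxSet φ₁ τ p) (hw : w ∈ proxSet φ₂ τ h)
    (hp₁ : φ₁ p ≠ ⊤) (hh₂ : φ₂ h ≠ ⊤) (hδ : 0 ≤ δ)
    (hδ₁ : (φ₁ w).toReal - (φ₁ h).toReal ≤ δ) (hδ₂ : (φ₂ h).toReal - (φ₂ p).toReal ≤ δ)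
    {g : ℝ} (hg : g = 4 * ((φ₁ p).toReal + (φ₂ p).toReal -
      ((φ₁ w).toReal + (φ₂ w).toReal) + 3 * δ)) :
    0 ≤ g ∧ dist p w ^ 2 ≤ τ * g ∧ (τ * g ≤ (r / 2) ^ 2 → ∀ y, φ₁ y ≠ ⊤ → φ₂ y ≠ ⊤ → 0 ≤ r →
      dist w y ≤ r / 2 → dist w y ^ 2 ≤ dist p y ^ 2 +
        2 * τ * ((φ₁ y).toReal + (φ₂ y).toReal - ((φ₁ w).toReal + (φ₂ w).toReal)) +
        Λ * τ * dist w y ^ 2 + Λ * τ * g) := by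
  have d₁ := dist_sq_le_of_mem_proxSet hτ hb₁ hh hp₁
  have d₂ := dist_sq_le_of_mem_proxSet hτ hb₂ hw hh₂
  -- Of the three `δ` in `g`, two pay for the energy mismatch in the dissipation of the half steps
  -- and the third is kept for the EVI. The factor `4` rather than `2` allows for `(a + b) ^ 2 ≤ 2
  -- (a ^ 2 + b ^ 2)`.
  have hsum : dist p h ^ 2 + dist h w ^ 2 + 2 * τ * δ ≤ τ * g / 2 := by
    have := mul_le_mul_of_nonneg_left hδ₁ hτ.le
    have := mul_le_mul_of_nonneg_left hδ₂ hτ.le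
    rw [hg]
    linarith
  have hδτ : 0 ≤ τ * δ := by positivity
  have hg0 : 0 ≤ g := nonneg_of_mul_nonneg_right (by
    linarith [sq_nonneg (dist p h), sq_nonneg (dist h w)] : 0 ≤ τ * g) hτ
  have hτg : 0 ≤ τ * g := by positivity
  refine ⟨hg0, ?_, fun hsmall y hy₁ hy₂ hr hyr => ?_⟩
  · have : dist p w ^ 2 ≤ (dist p h + dist h w) ^ 2 :=
      pow_le_pow_left₀ dist_nonneg (dist_triangle _ _ _) 2
    linarith [sq_nonneg (dist p h - dist h w)]
  · have hph : dist p h ≤ r / 2 :=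
      (abs_le_of_sq_le_sq' (by linarith [sq_nonneg (dist h w)]) (by positivity)).2
    have hhw : dist h w ≤ r / 2 :=
      (abs_le_of_sq_le_sq' (by linarith [sq_nonneg (dist p h)]) (by positivity)).2
    -- The radius is halved so that the midpoint `h` is also within `r` of `y`.
    have hhy : dist h y ≤ r := by linarith [dist_triangle h w y]
    have v₁ := he₁ τ hτ p h y hh hy₁ (by linarith) hhy
    have v₂ := he₂ τ hτ h w y hw hy₂ (by linarith) (by linarith)
    have hhy2 : dist h y ^ 2 ≤ 2 * (dist h w ^ 2 + dist w y ^ 2) := by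
      have : dist h y ^ 2 ≤ (dist h w + dist w y) ^ 2 :=
        pow_le_pow_left₀ dist_nonneg (dist_triangle _ _ _) 2
      linarith [sq_nonneg (dist h w - dist w y)]
    have k1 := mul_le_mul_of_nonneg_left hhy2 (by positivity : 0 ≤ L₁ * τ)
    have k2 : L₁ * τ * dist h w ^ 2 ≤ L₁ * (τ * g) := by
      rw [mul_assoc]
      refine mul_le_mul_of_nonneg_left ?_ hL₁
      have : τ * dist h w ^ 2 ≤ 1 * dist h w ^ 2 := mul_le_mul_of_nonneg_right hτ1 (sq_nonneg _)
      linarith [sq_nonneg (dist p h)]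
    have k3 : C * (dist p h ^ 2 + dist h w ^ 2) ≤ C * (τ * g) :=
      mul_le_mul_of_nonneg_left (by linarith) hC
    have k4 := mul_le_mul_of_nonneg_right hΛ hτg
    have k5 := mul_le_mul_of_nonneg_right hΛ (by positivity : 0 ≤ τ * dist w y ^ 2)
    have k6 : 0 ≤ (C + 1) * (τ * dist w y ^ 2) := by positivity
    -- The first half step gives the EVI with `φ₁ h`; replacing it by `φ₁ w` costs `2 τ δ`.
    have k7 := mul_le_mul_of_nonneg_left hδ₁ hτ.le
    have k8 : 0 ≤ L₂ * (τ * g) := by positivity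
    linarith [sq_nonneg (dist p h), sq_nonneg (dist h w)]

/-- The energy differences telescope and the increments sum to at most `Δ`. Finiteness of the
increments also keeps the scheme inside the domain of the sum up to time `T`. -/
theorem IsSplitSolution.isEVISeq {r C L₁ L₂ Λ M T m b Δ : ℝ}
    (hb₁ : ∀ x, φ₁ x ≠ ⊥) (hb₂ : ∀ x, φ₂ x ≠ ⊥)
    (he₁ : HasLocalEVI φ₁ r C L₁) (he₂ : HasLocalEVI φ₂ r C L₂) (hr : 0 ≤ r)
    (hL₁ : 0 ≤ L₁) (hL₂ : 0 ≤ L₂) (hC : 0 ≤ C) (hΛ : C + 1 + 2 * L₁ + L₂ ≤ Λ)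
    (hb : ∀ x, (b : EReal) ≤ φ₁ x + φ₂ x) (h₁ : φ₁ z₀ ≠ ⊤) (h₂ : φ₂ z₀ ≠ ⊤)
    (hM : 4 * ((φ₁ z₀ + φ₂ z₀).toReal - b + 3 * Δ) ≤ M) (hmM : m * M ≤ (r / 2) ^ 2)
    (hm1 : m ≤ 1) (hm : ∀ k, P.step k ≤ m)
    (hΔ : ∀ N, P.t N ≤ T → ∑ k ∈ Finset.range N, increment φ₁ φ₂ zh z k ≤ (Δ : EReal))
    (hz : IsSplitSolution φ₁ φ₂ P z₀ zh z) :
    IsEVISeq {y | φ₁ y + φ₂ y ≠ ⊤} (fun y => (φ₁ y + φ₂ y).toReal) (r / 2) Λ M T m P z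
      (fun k => 4 * ((φ₁ (z k) + φ₂ (z k)).toReal - (φ₁ (z (k + 1)) + φ₂ (z (k + 1))).toReal +
        3 * (increment φ₁ φ₂ zh z k).toReal)) := by
  have hm0 : 0 ≤ m := (P.step_pos 0).le.trans (hm 0)
  have hinc : ∀ N, P.t N ≤ T → ∀ k < N, increment φ₁ φ₂ zh z k ≠ ⊤ := fun N hN k hk =>
    increment_ne_top (hΔ N hN) hk
  have hfin : ∀ k, P.t k ≤ T → φ₁ (z k) ≠ ⊤ ∧ φ₂ (z k) ≠ ⊤ := fun k hk =>
    hz.ne_top (hinc k hk) h₁ h₂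
  have hfin' : ∀ k, P.t k ≤ T → φ₁ (z k) + φ₂ (z k) ≠ ⊤ := fun k hk =>
    EReal.add_ne_top (hfin k hk).1 (hfin k hk).2
  have hadd : ∀ x, φ₁ x ≠ ⊤ → φ₂ x ≠ ⊤ →
      (φ₁ x + φ₂ x).toReal = (φ₁ x).toReal + (φ₂ x).toReal := fun x a c =>
    EReal.toReal_add a (hb₁ x) c (hb₂ x)
  have hsum : ∀ N, P.t N ≤ T → ∑ k ∈ Finset.range N,
      4 * ((φ₁ (z k) + φ₂ (z k)).toReal - (φ₁ (z (k + 1)) + φ₂ (z (k + 1))).toReal +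
        3 * (increment φ₁ φ₂ zh z k).toReal) ≤ M := by
    intro N hN
    have e : ∑ k ∈ Finset.range N, (increment φ₁ φ₂ zh z k).toReal ≤ Δ := by
      rw [← EReal.coe_le_coe_iff, ereal_coe_sum]
      refine le_of_eq_of_le (Finset.sum_congr rfl fun k hk => ?_) (hΔ N hN)
      exact EReal.coe_toReal (hinc N hN k (Finset.mem_range.1 hk))
        (ne_bot_of_le_ne_bot EReal.zero_ne_bot (increment_nonneg φ₁ φ₂ zh z k))
    rw [← Finset.mul_sum, Finset.sum_add_distrib, ← Finset.mul_sum, Finset.sum_range_sub'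
      (fun k => (φ₁ (z k) + φ₂ (z k)).toReal), hz.1]
    have := hb (z N)
    rw [← EReal.coe_toReal (hfin' N hN) (add_ne_bot hb₁ hb₂ _), EReal.coe_le_coe_iff] at this
    linarith
  have hstep := fun k (hk : P.t (k + 1) ≤ T) => by
    have hk' := hfin k ((P.t_le_succ k).trans hk)
    have hi := hinc (k + 1) hk k (Nat.lt_succ_self k)
    obtain ⟨a₁, a₂, c₁, c₂⟩ := hz.ne_top_succ hi hk'.1 hk'.2
    refine split_step (g := 4 * ((φ₁ (z k) + φ₂ (z k)).toReal -
      (φ₁ (z (k + 1)) + φ₂ (z (k + 1))).toReal + 3 * (increment φ₁ φ₂ zh z k).toReal))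
      hb₁ hb₂ he₁ he₂ hL₁ hL₂ hC hΛ (P.step_pos k) ((hm k).trans hm1) (hz.2 k).1 (hz.2 k).2
      hk'.1 a₂ (EReal.toReal_nonneg (increment_nonneg φ₁ φ₂ zh z k))
      (toReal_sub_le c₁ (hb₁ _) a₁ (hb₁ _) hi ((le_max_right _ _).trans (le_max_right _ _)))
      (toReal_sub_le a₂ (hb₂ _) hk'.2 (hb₂ _) hi ((le_max_left _ _).trans (le_max_right _ _)))
      (by rw [hadd _ hk'.1 hk'.2, hadd _ c₁ c₂])
  refine ⟨hm, hfin', fun k hk => (hstep k hk).1, hsum, fun k hk => (hstep k hk).2.1,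
    fun k hk y hy hyr => ?_⟩
  obtain ⟨y₁, y₂⟩ := ne_top_of_add_ne_top hb₁ hb₂ hy
  obtain ⟨c₁, c₂⟩ := hfin (k + 1) hk
  rw [hadd y y₁ y₂, hadd _ c₁ c₂]
  have hgM := (Finset.single_le_sum (fun i hi => (hstep i ((P.strictMono.monotone
    (by have := Finset.mem_range.1 hi; omega)).trans hk)).1)
    (Finset.self_mem_range_succ k)).trans (hsum (k + 1) hk)
  have := (hstep k hk).2.2 ((mul_le_mul (hm k) hgM (hstep k hk).1 hm0).trans hmM) y y₁ y₂ hr hyr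
  rwa [hadd _ c₁ c₂] at this

end Split

/-! ### Convergence -/

/-- The two geometric settings both yield local variational inequalities. -/
theorem exists_hasLocalEVI {X : Type*} [MetricSpace X] {φ₁ φ₂ : X → EReal} {l₁ l₂ : ℝ}
    (hb₁ : ∀ x, φ₁ x ≠ ⊥) (hb₂ : ∀ x, φ₂ x ≠ ⊥)
    (hcase : (IsCAT1 X ∧ IsLConvex l₁ φ₁ ∧ IsLConvex l₂ φ₂) ∨
      (∃ (Γ : Set (ℝ → X)) (K : ℝ), IsGeodesicFamily Γ ∧ IsCommutative Γ ∧
        SqDistConvexAlong Γ K ∧ IsLConvexAlong Γ l₁ φ₁ ∧ IsLConvexAlong Γ l₂ φ₂)) :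
    ∃ C : ℝ, 0 ≤ C ∧ HasLocalEVI φ₁ 1 C |l₁| ∧ HasLocalEVI φ₂ 1 C |l₂| ∧
      HasLocalEVI (fun x => φ₁ x + φ₂ x) 1 C |l₁ + l₂| := by
  suffices h : ∃ C : ℝ, 0 ≤ C ∧ IsLocallyConvex φ₁ 1 C l₁ ∧ IsLocallyConvex φ₂ 1 C l₂ ∧
      IsLocallyConvex (fun x => φ₁ x + φ₂ x) 1 C (l₁ + l₂) by
    obtain ⟨C, hC, h₁, h₂, h₁₂⟩ := h
    exact ⟨C, hC, h₁.hasLocalEVI hb₁, h₂.hasLocalEVI hb₂, h₁₂.hasLocalEVI (add_ne_bot hb₁ hb₂)⟩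
  rcases hcase with ⟨hX, h₁, h₂⟩ | ⟨Γ, K, hΓ, hcomm, hK, h₁, h₂⟩
  · refine ⟨10, by norm_num, fun z y hz hy _ => ?_, fun z y hz hy _ => ?_,
      fun z y hz hy hzy => ?_⟩
    · obtain ⟨γ, hγ, h0, h1, hc⟩ := h₁ z hz y hy
      exact ⟨γ, h0, h1, hX.hasVariationBound hγ, hc⟩
    · obtain ⟨γ, hγ, h0, h1, hc⟩ := h₂ z hz y hy
      exact ⟨γ, h0, h1, hX.hasVariationBound hγ, hc⟩
    · have hz' := ne_top_of_add_ne_top hb₁ hb₂ hz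
      have hy' := ne_top_of_add_ne_top hb₁ hb₂ hy
      obtain ⟨γ, hγ, h0, h1, hc⟩ := h₁ z hz'.1 y hy'.1
      obtain ⟨η, hη, k0, k1, hc'⟩ := h₂ z hz'.2 y hy'.2
      refine ⟨γ, h0, h1, hX.hasVariationBound hγ, ConvexAlong.add hb₁ hb₂ (by rwa [h0])
        (by rwa [h1]) hc fun t ht => ?_⟩
      have := hc' t ht
      -- The functions are convex along possibly different geodesics; these coincide because the end
      -- points are at distance at most `1 < π / 2`.
      rwa [hX.geodesic_unique hγ hη (k0.trans h0.symm) (k1.trans h1.symm)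
        (by rw [h0, h1]; linarith [Real.pi_gt_three]) ht, k0, k1, ← h0, ← h1] at this
  · refine ⟨|K| / 2, by positivity, fun z y hz hy _ => ?_, fun z y hz hy _ => ?_,
      fun z y hz hy _ => ?_⟩ <;> obtain ⟨γ, hγ, rfl, rfl⟩ := hΓ.2 z y <;>
      refine ⟨γ, rfl, rfl, hasVariationBound_of_isCommutative hΓ hcomm hK hγ 1, ?_⟩
    · exact h₁ γ hγ hz hy
    · exact h₂ γ hγ hz hy
    · have hz' := ne_top_of_add_ne_top hb₁ hb₂ hz
      have hy' := ne_top_of_add_ne_top hb₁ hb₂ hy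
      exact ConvexAlong.add hb₁ hb₂ hz hy (h₁ γ hγ hz'.1 hy'.1) (h₂ γ hγ hz'.2 hy'.2)

/-- `z` is a discrete solution of the sum or a solution of the alternating scheme. -/
def IsSchemeSolution {X : Type*} [MetricSpace X] (φ₁ φ₂ : X → EReal) (P : TimePartition) (z₀ : X)
    (z : ℕ → X) : Prop :=
  IsDiscreteSolution (fun x => φ₁ x + φ₂ x) P z₀ z ∨ ∃ zh, IsSplitSolution φ₁ φ₂ P z₀ zh z

theorem exists_dist_interp_le {X : Type*} [MetricSpace X] [BoundedSpace X] {φ₁ φ₂ : X → EReal}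
    {C L₁ L₂ L b : ℝ} {z₀ : X} (hb₁ : ∀ x, φ₁ x ≠ ⊥) (hb₂ : ∀ x, φ₂ x ≠ ⊥) (hC : 0 ≤ C)
    (hL₁ : 0 ≤ L₁) (hL₂ : 0 ≤ L₂) (hL : 0 ≤ L) (he₁ : HasLocalEVI φ₁ 1 C L₁)
    (he₂ : HasLocalEVI φ₂ 1 C L₂) (he : HasLocalEVI (fun x => φ₁ x + φ₂ x) 1 C L)
    (hb : ∀ x, (b : EReal) ≤ φ₁ x + φ₂ x) (h₁ : φ₁ z₀ ≠ ⊤) (h₂ : φ₂ z₀ ≠ ⊤)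
    (hsum : IncrementsSummable φ₁ φ₂ z₀) {T ρ : ℝ} (hT : 0 < T) (hρ : 0 < ρ) :
    ∃ η : ℝ, 0 < η ∧ ∀ (P Q : TimePartition) (z w : ℕ → X), P.mesh < (η : EReal) →
      Q.mesh < (η : EReal) → IsSchemeSolution φ₁ φ₂ P z₀ z → IsSchemeSolution φ₁ φ₂ Q z₀ w →
      ∀ t ∈ Icc 0 T, dist (interp P z t) (interp Q w t) ≤ ρ := by
  -- The horizon is `T + 1` because the node representing a time `t ≤ T` may lie later by up to the
  -- mesh bound `m ≤ 1`.
  obtain ⟨Δ, hΔ⟩ := hsum 1 one_pos (T + 1) (by linarith)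
  set Λ := C + 1 + 2 * L₁ + L₂ + L with hΛ
  have hΛ0 : 0 ≤ Λ := by positivity
  set G := (φ₁ z₀ + φ₂ z₀).toReal - b with hG
  have hG0 : 0 ≤ G := by
    have := hb z₀
    rw [← EReal.coe_toReal (EReal.add_ne_top h₁ h₂) (add_ne_bot hb₁ hb₂ _),
      EReal.coe_le_coe_iff] at this
    exact sub_nonneg.2 this
  -- One constant serves both schemes; the summand `1` makes it positive.
  set M := 4 * G + 12 * |Δ| + 1 with hM
  have hM0 : 0 < M := by positivity
  obtain ⟨η, hη, h⟩ := IsEVISeq.exists_dist_le {y : X | φ₁ y + φ₂ y ≠ ⊤}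
    (fun y => (φ₁ y + φ₂ y).toReal) (by norm_num : (0 : ℝ) < 1 / 2) hΛ0 hM0
    (by linarith : 0 ≤ T + 1) hρ
  set m := min η (min 1 (1 / (4 * M))) with hm
  have hm0 : 0 < m := lt_min hη (lt_min one_pos (by positivity))
  have hm1 : m ≤ 1 := (min_le_right _ _).trans (min_le_left _ _)
  have hmM : m * M ≤ 1 / 4 := by
    have : m ≤ 1 / (4 * M) := (min_le_right _ _).trans (min_le_right _ _)
    rw [le_div_iff₀ (by positivity)] at this
    linarith
  have hseq : ∀ (P : TimePartition) (z : ℕ → X), P.mesh < (m : EReal) →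
      IsSchemeSolution φ₁ φ₂ P z₀ z → z 0 = z₀ ∧ ∃ g,
        IsEVISeq {y : X | φ₁ y + φ₂ y ≠ ⊤} (fun y => (φ₁ y + φ₂ y).toReal) (1 / 2) Λ M (T + 1) m
          P z g := by
    rintro P z hP (hz | ⟨zh, hz⟩)
    · refine ⟨hz.1, _, (hz.isEVISeq (r := 1 / 2) (C := C) (L := L) (T + 1)
        (add_ne_bot hb₁ hb₂) (fun τ hτ x z y a c d e => he τ hτ x z y a c (by linarith)
          (by linarith)) (by norm_num) hb (EReal.add_ne_top h₁ h₂) (by linarith) (by linarith) hΛ0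
        ?_ (by linarith) (TimePartition.step_le_of_mesh_lt hP))⟩
      rw [hM]; linarith [abs_nonneg Δ]
    · refine ⟨hz.1, _, hz.isEVISeq (r := 1) hb₁ hb₂ he₁ he₂ zero_le_one hL₁ hL₂ hC
        (by linarith) hb h₁ h₂ ?_ (by linarith) hm1 (TimePartition.step_le_of_mesh_lt hP)
        fun N hN => hΔ P (hP.trans_le (by exact_mod_cast hm1)) N hN zh z hz⟩
      rw [hM]; linarith [le_abs_self Δ]
  refine ⟨m, hm0, fun P Q z w hP hQ hz hw t ht => ?_⟩
  obtain ⟨hz0, g, hg⟩ := hseq P z hP hz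
  obtain ⟨hw0, f, hf⟩ := hseq Q w hQ hw
  obtain ⟨j, ej, j1, j2⟩ := interp_eq P z hg.step_le ht.1
  obtain ⟨k, ek, k1, k2⟩ := interp_eq Q w hf.step_le ht.1
  rw [ej, ek]
  exact h m (min_le_left _ _) P Q z w g f hg hf (hz0.trans hw0.symm) j k
    (by linarith [ht.2]) (by linarith [ht.2]) (abs_le.2 ⟨by linarith, by linarith⟩)

/-- The partition into intervals of length `1 / (n + 1)`. -/
noncomputable def uniformPartition (n : ℕ) : TimePartition where
  t k := k * (1 / ((n : ℝ) + 1))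
  t_zero := by simp
  strictMono := fun i j hij =>
    mul_lt_mul_of_pos_right (Nat.cast_lt.2 hij) Nat.one_div_pos_of_nat
  tendsto := tendsto_natCast_atTop_atTop.atTop_mul_const Nat.one_div_pos_of_nat

theorem mesh_uniformPartition (n : ℕ) :
    (uniformPartition n).mesh = ((1 / ((n : ℝ) + 1) : ℝ) : EReal) := by
  have : ∀ k, (uniformPartition n).step k = 1 / ((n : ℝ) + 1) := fun k => by
    simp only [TimePartition.step, uniformPartition]
    push_cast
    ring
  simp only [TimePartition.mesh, this, ciSup_const]

theorem tendsto_mesh_uniformPartition :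
    Tendsto (fun n => (uniformPartition n).mesh) atTop (𝓝 0) := by
  simp only [mesh_uniformPartition]
  exact (continuous_coe_real_ereal.tendsto 0).comp tendsto_one_div_add_atTop_nhds_zero_nat

end TrotterKato

/-! ### The product formula -/

theorem theorem5p1 {X : Type*} [MetricSpace X] [CompleteSpace X] [BoundedSpace X]
    (φ₁ φ₂ : X → EReal) (l₁ l₂ : ℝ)
    (hbot₁ : ∀ x, φ₁ x ≠ ⊥) (hbot₂ : ∀ x, φ₂ x ≠ ⊥)
    (hlsc₁ : LowerSemicontinuous φ₁) (hlsc₂ : LowerSemicontinuous φ₂)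
    (hcpt₁ : TrotterKato.SublevelsCompact φ₁) (hcpt₂ : TrotterKato.SublevelsCompact φ₂)
    (hcase :
      (TrotterKato.IsCAT1 X ∧ TrotterKato.IsLConvex l₁ φ₁ ∧ TrotterKato.IsLConvex l₂ φ₂) ∨
      (∃ (Γ : Set (ℝ → X)) (K : ℝ), TrotterKato.IsGeodesicFamily Γ ∧
        TrotterKato.IsCommutative Γ ∧ TrotterKato.SqDistConvexAlong Γ K ∧
        TrotterKato.IsLConvexAlong Γ l₁ φ₁ ∧ TrotterKato.IsLConvexAlong Γ l₂ φ₂))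
    (z₀ : X) (hz₀ : z₀ ∈ TrotterKato.effDomain (fun x => φ₁ x + φ₂ x))
    (hsum : TrotterKato.IncrementsSummable φ₁ φ₂ z₀) :
    -- the alternating scheme is solvable for every partition
    (∀ P : TrotterKato.TimePartition,
      ∃ zh z : ℕ → X, TrotterKato.IsSplitSolution φ₁ φ₂ P z₀ zh z) ∧
    -- there is exactly one gradient curve of the sum, and the scheme converges to it
    ∃ ξ : ℝ → X,
      TrotterKato.IsGradientCurve (fun x => φ₁ x + φ₂ x) z₀ ξ ∧
      (∀ ξ' : ℝ → X, TrotterKato.IsGradientCurve (fun x => φ₁ x + φ₂ x) z₀ ξ' →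
        ∀ t : ℝ, 0 ≤ t → ξ' t = ξ t) ∧
      ∀ T : ℝ, 0 < T → ∀ ρ : ℝ, 0 < ρ → ∃ η : ℝ, 0 < η ∧
        ∀ P : TrotterKato.TimePartition, P.mesh < (η : EReal) →
          ∀ zh z : ℕ → X, TrotterKato.IsSplitSolution φ₁ φ₂ P z₀ zh z →
            ∀ t ∈ Set.Icc (0 : ℝ) T, dist (TrotterKato.interp P z t) (ξ t) < ρ := by
  open TrotterKato in
  obtain ⟨h₁, h₂⟩ := ne_top_of_add_ne_top hbot₁ hbot₂ hz₀
  have hlsc := lowerSemicontinuous_add hbot₁ hbot₂ hlsc₁ hlsc₂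
  have hcpt := sublevelsCompact_add hbot₁ hcpt₁ (exists_real_le hbot₂ hlsc₂ hcpt₂ ⟨z₀, h₂⟩)
  have hbot := add_ne_bot hbot₁ hbot₂
  refine ⟨fun P => exists_isSplitSolution
    (fun τ hτ => proxSet_nonempty hbot₁ hlsc₁ hcpt₁ ⟨z₀, h₁⟩ hτ)
    (fun τ hτ => proxSet_nonempty hbot₂ hlsc₂ hcpt₂ ⟨z₀, h₂⟩ hτ) P z₀, ?_⟩
  obtain ⟨C, hC, he₁, he₂, he⟩ := exists_hasLocalEVI hbot₁ hbot₂ hcase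
  obtain ⟨b, hb⟩ := exists_real_le hbot hlsc hcpt ⟨z₀, hz₀⟩
  have hcomp : ∀ {T ρ : ℝ}, 0 < T → 0 < ρ → _ := fun {T ρ} hT hρ =>
    exists_dist_interp_le hbot₁ hbot₂ hC (abs_nonneg l₁) (abs_nonneg l₂) (abs_nonneg (l₁ + l₂))
      he₁ he₂ he hb h₁ h₂ hsum (T := T) (ρ := ρ) hT hρ
  -- Discrete solutions of the sum on uniform partitions serve as the reference family that defines
  -- the limit curve.
  choose x hx using fun n => exists_isDiscreteSolution
    (fun τ hτ => proxSet_nonempty hbot hlsc hcpt ⟨z₀, hz₀⟩ hτ) (uniformPartition n) z₀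
  have hmesh : ∀ {P : ℕ → TimePartition}, Tendsto (fun n => (P n).mesh) atTop (𝓝 0) →
      ∀ {η : ℝ}, 0 < η → ∀ᶠ n in atTop, (P n).mesh < (η : EReal) := fun h η hη =>
    h.eventually_lt_const (by exact_mod_cast hη)
  have hlim : ∀ t : ℝ, ∃ y, 0 ≤ t →
      Tendsto (fun n => interp (uniformPartition n) (x n) t) atTop (𝓝 y) := by
    intro t
    by_cases ht : 0 ≤ t
    · suffices hc : CauchySeq fun n => interp (uniformPartition n) (x n) t by
        obtain ⟨y, hy⟩ := cauchySeq_tendsto_of_complete hc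
        exact ⟨y, fun _ => hy⟩
      refine Metric.cauchySeq_iff.2 fun ρ hρ => ?_
      obtain ⟨η, hη, h⟩ := hcomp (by linarith : 0 < t + 1) (half_pos hρ)
      obtain ⟨N, hN⟩ := eventually_atTop.1 (hmesh tendsto_mesh_uniformPartition hη)
      refine ⟨N, fun n hn k hk => (h _ _ _ _ (hN n hn) (hN k hk) (Or.inl (hx n)) (Or.inl (hx k))
        t ⟨ht, by linarith⟩).trans_lt (half_lt_self hρ)⟩
    · exact ⟨z₀, fun h => absurd h ht⟩
  choose ξ hξ using hlim
  have hconv : ∀ T : ℝ, 0 < T → ∀ ρ : ℝ, 0 < ρ → ∃ η : ℝ, 0 < η ∧ ∀ (P : TimePartition)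
      (z : ℕ → X), P.mesh < (η : EReal) → IsSchemeSolution φ₁ φ₂ P z₀ z →
      ∀ t ∈ Icc (0 : ℝ) T, dist (interp P z t) (ξ t) < ρ := by
    intro T hT ρ hρ
    obtain ⟨η, hη, h⟩ := hcomp hT (half_pos hρ)
    refine ⟨η, hη, fun P z hP hz t ht => lt_of_le_of_lt ?_ (half_lt_self hρ)⟩
    refine le_of_tendsto (tendsto_const_nhds.dist (hξ t ht.1)) ?_
    filter_upwards [hmesh tendsto_mesh_uniformPartition hη] with n hn
    exact h _ _ _ _ hP hn hz (Or.inl (hx n)) t ht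
  refine ⟨ξ, ⟨uniformPartition, x, hx, tendsto_mesh_uniformPartition, fun t ht => hξ t ht⟩, ?_, ?_⟩
  -- The approximations of any other gradient curve are themselves scheme solutions, hence converge
  -- to `ξ` as well.
  · rintro ξ' ⟨P, y, hy, hP, hlim⟩ t ht
    refine tendsto_nhds_unique (hlim t ht) (Metric.tendsto_nhds.2 fun ρ hρ => ?_)
    obtain ⟨η, hη, h⟩ := hconv (t + 1) (by linarith) ρ hρ
    filter_upwards [hmesh hP hη] with n hn
    exact h _ _ hn (Or.inl (hy n)) t ⟨ht, by linarith⟩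
  · intro T hT ρ hρ
    obtain ⟨η, hη, h⟩ := hconv T hT ρ hρ
    exact ⟨η, hη, fun P hP zh z hz => h P z hP (Or.inr ⟨zh, hz⟩)⟩
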